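/- **Theorem (Local intertwiner).** *Setting.* Let $(\mathbb T,\omega)$ be a $2n$-dimensional real symplectic vector space with Liouville measure $\mathcal L$, let $h\in\mathbb R\setminus\{0\}$ and $e_h(t)=e^{2\pi i h t}$. Let $\mathfrak H=\mathbb R\times\mathbb T$ be the Heisenberg group, with $(t,z)(t',z')=(t+t'+\tfrac12\omega(z,z'),\,z+z')$. For complementary Lagrangian subspaces $\mathbb A,\mathbb B$ write $[\mathbb{AB}]_+$ for the projection of $\mathbb T$ onto $\mathbb A$ along $\mathbb B$ and $[\mathbb{AB}]$ for the operator equal to $1$ on $\mathbb A$ and $-1$ on $\mathbb B$. Let $\mathscr S_{\mathbb A}(\mathfrak H)$ be the space of functions $\psi:\mathfrak H\to\mathbb C$ with $\psi((c,0)g)=e_h(c)\psi(g)$ and $\psi(g\,(0,a))=\psi(g)$ for $a\in\mathbb A$, whose restriction to every Lagrangian complement of $\mathbb A$ is Schwartz. For complementary $\mathbb A,\mathbb X$ define $$\operatorname{ind}:\mathscr S(\mathbb X)\to\mathscr S_{\mathbb A}(\mathfrak H),\qquad (\operatorname{ind}f)(t,z)=e_h\!\left(t-\tfrac12\omega([\mathbb{XA}]_+z,z)\right)f([\mathbb{XA}]_+z),$$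 $$\operatorname{res}:\mathscr S_{\mathbb A}(\mathfrak H)\to\mathscr S(\mathbb X),\qquad (\operatorname{res}\psi)(x)=\psi(0,x).$$ For complementary $\mathbb A,\mathbb B$ with Haar measures $\mu_{\mathbb A},\mu_{\mathbb B}$ define $$\delta_{\mathbb B}*:\mathscr S_{\mathbb A}(\mathfrak H)\to\mathscr S_{\mathbb B}(\mathfrak H),\qquad (\delta_{\mathbb B}*\psi)(g)=\int_{\mathbb B}\psi(g\,(0,b))\,d_hb,\qquad d_hb=|h|^{n/2}\left(\frac{d\mu_{\mathbb A}\,d\mu_{\mathbb B}}{d\mathcal L}\right)^{-1/2}d\mu_{\mathbb B}(b)$$ ($d_hb$ is the self-dual measure relative to $\mathbb A$). Let $\mathbb U\subset\mathbb R$ be an interval and $u\mapsto\mathbb H(u)$, $u\in\mathbb U$, a positive Lagrangian curve: for each $t\in\mathbb U$ and each Lagrangian complement $\mathbb X$ of $\mathbb H(t)$, for $u$ near $t$ one has $\mathbb H(u)=\{S(u)v+v\mid v\in\mathbb H(t)\}$ with $S(u):\mathbb H(t)\to\mathbb X$ differentiable at $u=t$ and $\omega(\dot S(t)v,v)>0$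 for $0\neq v\in\mathbb H(t)$. Fix a Haar measure on each $\mathbb H(u)$. Let $\mathfrak F$ be a field bundle on the associated plane wave, i.e. a bundle of complex vector spaces over $\bigsqcup_{u\in\mathbb U}\mathfrak H/\mathbb H(u)$ with a linear action of $\mathfrak H$ covering the action on the base, and with a parallel transport $\Gamma_{su}:\mathfrak F(s)\to\mathfrak F(u)$ along the central null geodesic ($\mathfrak F(u)$ being the fibre over the identity coset in $\mathfrak H/\mathbb H(u)$; $\Gamma_{ss}=1$ and $\Gamma_{su}\Gamma_{rs}=\Gamma_{ru}$). For a Lagrangian subspace $\mathbb X$ complementary to every $\mathbb H(u)$, with some Haar measure (its choice does not affect the result), the Schrödinger evolution $\Phi_{\mathbb X}(s,u):\mathscr S(\mathbb X)\otimes\mathfrak F(s)\to\mathscr S(\mathbb X)\otimes\mathfrak F(u)$ is the composite $$\mathscr S(\mathbb X)\otimes\mathfrak F(s)\xrightarrow{\operatorname{ind}}\mathscr S_{\mathbb H(s)}(\mathfrak H)\otimes\mathfrak F(s)\xrightarrow{\delta_{\mathbb X}*}\mathscr S_{\mathbb X}(\mathfrak H)\otimes\mathfrak F(s)\xrightarrow{\Gamma_{su}}\mathscr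 S_{\mathbb X}(\mathfrak H)\otimes\mathfrak F(u)\xrightarrow{\delta_{\mathbb H(u)}*}\mathscr S_{\mathbb H(u)}(\mathfrak H)\otimes\mathfrak F(u)\xrightarrow{\operatorname{res}}\mathscr S(\mathbb X)\otimes\mathfrak F(u).$$ *Statement.* Let $\mathbb X,\mathbb X'$ be Lagrangian subspaces, each complementary to $\mathbb H(u)$ for all $u\in\mathbb U$, and fix $s\in\mathbb U$. Write $\mathbb X'=\{Yz+z\mid z\in\mathbb X\}$ with $Y:\mathbb X\to\mathbb H(s)$, and $\mathbb H(u)=\{K(u)v+v\mid v\in\mathbb H(s)\}$ with $K(u):\mathbb H(s)\to\mathbb X$. Assume that $\mathbb X,\mathbb X'$ are sufficiently close, in the sense that for every $u\in\mathbb U$ the operator $I-YK(u)$ on $\mathbb H(s)$ is positive-definite (i.e. $\langle v,(I-YK(u))v\rangle>0$ for all $v\ne0$, for some inner product on $\mathbb H(s)$). Let $M_u=\tfrac12\left([\mathbb H(u)\mathbb X]+[\mathbb H(u)\mathbb X']\right)$, the symplectic reflection that is the identity on $\mathbb H(u)$ and exchanges $\mathbb X$ and $\mathbb X'$. Then for each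 $u\in\mathbb U$ $$\rho_uf(z)=e_h\!\left(\tfrac12\omega([\mathbb H(u)\mathbb X]_+z,z)\right)f(-M_uz),\qquad z\in\mathbb X',$$ defines a linear isomorphism $\rho_u:\mathscr S(\mathbb X)\to\mathscr S(\mathbb X')$ with inverse $$\rho_u^{-1}f(z)=e_h\!\left(\tfrac12\omega([\mathbb H(u)\mathbb X']_+z,z)\right)f(-M_uz),\qquad z\in\mathbb X,$$ and for every $u\in\mathbb U$ $$(\rho_u\otimes1)\circ\Phi_{\mathbb X}(s,u)=\Phi_{\mathbb X'}(s,u)\circ(\rho_s\otimes1).$$ -/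

import Mathlib

open MeasureTheory Topology
open scoped SchwartzMap TensorProduct NNReal

set_option linter.unusedSectionVars false

noncomputable section

namespace PlaneWave

/-- A symplectic form on a real vector space: a nondegenerate alternating bilinear form. -/
structure SymplecticForm (T : Type*) [AddCommGroup T] [Module ℝ T] where
  form : LinearMap.BilinForm ℝ T
  alt : ∀ x, form x x = 0
  nondegenerate : ∀ x, (∀ y, form x y = 0) → x = 0

instance {T : Type*} [AddCommGroup T] [Module ℝ T] :
    CoeFun (SymplecticForm T) fun _ => T → T →ₗ[ℝ] ℝ := ⟨fun ω => ω.form⟩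

section Algebra

variable {T : Type*} [AddCommGroup T] [Module ℝ T]

theorem SymplecticForm.neg_eq (ω : SymplecticForm T) (x y : T) : -ω x y = ω y x :=
  LinearMap.IsAlt.neg ω.alt x y

/-- A Lagrangian subspace: a subspace equal to its own symplectic orthogonal. -/
structure Lagrangian (ω : SymplecticForm T) where
  toSubmodule : Submodule ℝ T
  mem_iff : ∀ z, z ∈ toSubmodule ↔ ∀ w ∈ toSubmodule, ω z w = 0

variable {ω : SymplecticForm T}

instance : CoeSort (Lagrangian ω) (Type _) := ⟨fun A => A.toSubmodule⟩

theorem Lagrangian.isotropic (A : Lagrangian ω) {x y : T} (hx : x ∈ A.toSubmodule)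
    (hy : y ∈ A.toSubmodule) : ω x y = 0 := (A.mem_iff x).1 hx y hy

/-- The two Lagrangian subspaces are complementary. -/
def Compl (A B : Lagrangian ω) : Prop := IsCompl A.toSubmodule B.toSubmodule

theorem Compl.symm {A B : Lagrangian ω} (hAB : Compl A B) : Compl B A := IsCompl.symm hAB

/-- The projection `[A B]₊` of `T` onto `A` along `B`. -/
def proj {A B : Lagrangian ω} (hAB : Compl A B) : T →ₗ[ℝ] T :=
  A.toSubmodule.projection B.toSubmodule hAB

/-- The real polarization `[A B]`, equal to `1` on `A` and to `-1` on `B`. -/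
def polarization {A B : Lagrangian ω} (hAB : Compl A B) : T →ₗ[ℝ] T :=
  proj hAB - proj hAB.symm

/-- The symplectic reflection `([H X] + [H X']) / 2`: it is the identity on `H` and exchanges
`X` and `X'`. -/
def reflection {H X X' : Lagrangian ω} (hX : Compl H X) (hX' : Compl H X') : T →ₗ[ℝ] T :=
  (1 / 2 : ℝ) • (polarization hX + polarization hX')

theorem proj_add_proj {A B : Lagrangian ω} (hAB : Compl A B) (z : T) :
    proj hAB z + proj hAB.symm z = z := Submodule.projection_add_projection_eq_self hAB z

theorem proj_mem {A B : Lagrangian ω} (hAB : Compl A B) (z : T) : proj hAB z ∈ A.toSubmodule :=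
  Submodule.projection_apply_mem hAB z

theorem proj_of_mem {A B : Lagrangian ω} (hAB : Compl A B) {z : T} (hz : z ∈ A.toSubmodule) :
    proj hAB z = z := Submodule.projection_apply_of_mem_left hAB hz

theorem proj_of_mem_right {A B : Lagrangian ω} (hAB : Compl A B) {z : T}
    (hz : z ∈ B.toSubmodule) : proj hAB z = 0 := by
  have h1 := proj_add_proj hAB z
  rw [proj_of_mem hAB.symm hz] at h1
  simpa using h1

theorem neg_reflection_apply {H X X' : Lagrangian ω} (hX : Compl H X) (hX' : Compl H X') {z : T}
    (hz : z ∈ X'.toSubmodule) : -reflection hX hX' z = proj hX.symm z := by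
  have h1 := proj_add_proj hX z
  have h2 : proj hX z = z - proj hX.symm z := eq_sub_of_add_eq h1
  simp only [reflection, polarization, LinearMap.smul_apply, LinearMap.add_apply,
    LinearMap.sub_apply, proj_of_mem_right hX' hz, proj_of_mem hX'.symm hz, h2]
  module

theorem neg_reflection_mem {H X X' : Lagrangian ω} (hX : Compl H X) (hX' : Compl H X')
    (z : X') : -reflection hX hX' z ∈ X.toSubmodule := by
  rw [neg_reflection_apply hX hX' z.2]
  exact proj_mem _ _

/-- The (universal cover of the) Heisenberg group of `(T, ω)`. -/
@[ext] structure Heisenberg (ω : SymplecticForm T) where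
  t : ℝ
  z : T

namespace Heisenberg

instance : Mul (Heisenberg ω) := ⟨fun g g' => ⟨g.t + g'.t + ω g.z g'.z / 2, g.z + g'.z⟩⟩
instance : One (Heisenberg ω) := ⟨⟨0, 0⟩⟩
instance : Inv (Heisenberg ω) := ⟨fun g => ⟨-g.t, -g.z⟩⟩

@[simp] theorem mul_t (g g' : Heisenberg ω) : (g * g').t = g.t + g'.t + ω g.z g'.z / 2 := rfl
@[simp] theorem mul_z (g g' : Heisenberg ω) : (g * g').z = g.z + g'.z := rfl
@[simp] theorem one_t : (1 : Heisenberg ω).t = 0 := rfl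
@[simp] theorem one_z : (1 : Heisenberg ω).z = 0 := rfl
@[simp] theorem inv_t (g : Heisenberg ω) : g⁻¹.t = -g.t := rfl
@[simp] theorem inv_z (g : Heisenberg ω) : g⁻¹.z = -g.z := rfl

instance : Group (Heisenberg ω) :=
  Group.ofLeftAxioms
    (fun a b c => by
      ext
      · simp; ring
      · simp [add_assoc])
    (fun a => by ext <;> simp)
    (fun a => by ext <;> simp [ω.alt])

/-- The image `{0} × A` of a Lagrangian subspace in the Heisenberg group. -/
def ofLagrangian (A : Lagrangian ω) : Subgroup (Heisenberg ω) where
  carrier := {g | g.t = 0 ∧ g.z ∈ A.toSubmodule}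
  mul_mem' := by
    rintro a b ⟨ha, ha'⟩ ⟨hb, hb'⟩
    exact ⟨by simp [ha, hb, A.isotropic ha' hb'], A.toSubmodule.add_mem ha' hb'⟩
  one_mem' := ⟨rfl, A.toSubmodule.zero_mem⟩
  inv_mem' := by
    rintro a ⟨ha, ha'⟩
    exact ⟨by simp [ha], A.toSubmodule.neg_mem ha'⟩

end Heisenberg

end Algebra

/-- The character `e_h(t) = exp (2 π i h t)`. -/
def eh (h t : ℝ) : ℂ := Complex.exp (2 * Real.pi * h * t * Complex.I)

theorem eh_add (h s t : ℝ) : eh h (s + t) = eh h s * eh h t := by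
  simp only [eh, ← Complex.exp_add]
  push_cast
  ring_nf

theorem eh_zero (h : ℝ) : eh h 0 = 1 := by simp [eh]

theorem norm_eh (h t : ℝ) : ‖eh h t‖ = 1 := by
  have : eh h t = Complex.exp (((2 * Real.pi * h * t : ℝ) : ℂ) * Complex.I) := by
    simp [eh]
  rw [this, Complex.norm_exp_ofReal_mul_I]

theorem continuous_eh (h : ℝ) : Continuous (eh h) := by unfold eh; fun_prop

theorem hasTemperateGrowth_eh (h : ℝ) : (eh h).HasTemperateGrowth := by
  have key : ∀ n : ℕ, iteratedDeriv n (eh h) =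
      fun t => (2 * Real.pi * h * Complex.I : ℂ) ^ n * eh h t := by
    intro n
    induction n with
    | zero => simp
    | succ n ih =>
      rw [iteratedDeriv_succ, ih]
      funext t
      have h1 : HasDerivAt (fun t : ℝ => (2 * Real.pi * h * t * Complex.I : ℂ))
          (2 * Real.pi * h * Complex.I) t := by
        have := ((Complex.ofRealCLM.hasDerivAt (x := t)).const_mul
          (2 * Real.pi * h : ℂ)).mul_const Complex.I
        simpa using this
      have h2 : HasDerivAt (eh h) (eh h t * (2 * Real.pi * h * Complex.I)) t := h1.cexp
      rw [(h2.const_mul _).deriv, pow_succ]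
      ring
  have hs : ContDiff ℝ ⊤ (eh h) := by
    unfold eh
    exact ((((contDiff_const.mul Complex.ofRealCLM.contDiff).mul contDiff_const)).cexp)
  refine ⟨hs.of_le le_top, fun n => ⟨0, ‖(2 * Real.pi * h * Complex.I : ℂ)‖ ^ n, fun t => ?_⟩⟩
  rw [norm_iteratedFDeriv_eq_norm_iteratedDeriv, key]
  simp [norm_eh]

section Analysis

variable {T : Type*} [NormedAddCommGroup T] [NormedSpace ℝ T] [FiniteDimensional ℝ T]
  {ω : SymplecticForm T}

/-- Multiplying a Schwartz function by a quadratic phase, after an injective linear substitution,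
gives a Schwartz function. -/
theorem exists_schwartz_quadratic {E F : Type*} [NormedAddCommGroup E] [NormedSpace ℝ E]
    [FiniteDimensional ℝ E] [NormedAddCommGroup F] [NormedSpace ℝ F] (ω : SymplecticForm T)
    (h : ℝ) (L : E →ₗ[ℝ] F) (hL : Function.Injective L) (P Q : E →ₗ[ℝ] T) (f : 𝓢(F, ℂ)) :
    ∃ f' : 𝓢(E, ℂ), ∀ x, f' x = eh h (ω (P x) (Q x)) * f (L x) := by
  obtain ⟨k, -, hk⟩ := L.exists_antilipschitzWith (LinearMap.ker_eq_bot.2 hL)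
  have hg : (fun x : E => eh h (ω (P x) (Q x))).HasTemperateGrowth := by
    have h1 : (fun x : E => ω.form.toContinuousBilinearMap
        (P.toContinuousLinearMap x) (Q.toContinuousLinearMap x)).HasTemperateGrowth :=
      ContinuousLinearMap.bilinear_hasTemperateGrowth (𝕜 := ℝ) _
        (ContinuousLinearMap.hasTemperateGrowth _) (ContinuousLinearMap.hasTemperateGrowth _)
    exact (hasTemperateGrowth_eh h).comp h1
  refine ⟨SchwartzMap.smulLeftCLM ℂ (fun x : E => eh h (ω (P x) (Q x)))
    (SchwartzMap.compCLMOfAntilipschitz ℂ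
      (ContinuousLinearMap.hasTemperateGrowth L.toContinuousLinearMap) hk f), fun x => ?_⟩
  rw [SchwartzMap.smulLeftCLM_apply_apply hg]
  simp

theorem exists_riesz {E F : Type*} [NormedAddCommGroup E] [InnerProductSpace ℝ E]
    [FiniteDimensional ℝ E] [AddCommGroup F] [Module ℝ F] (φ : F →ₗ[ℝ] E →ₗ[ℝ] ℝ) :
    ∃ L : F →ₗ[ℝ] E, ∀ a y, inner ℝ y (L a) = φ a y := by
  have key : ∀ a, ∃ x : E, ∀ y, inner ℝ y x = φ a y := fun a =>
    ⟨(InnerProductSpace.toDual ℝ E).symm (φ a).toContinuousLinearMap, fun y => by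
      rw [real_inner_comm, InnerProductSpace.toDual_symm_apply]; rfl⟩
  choose L hL using key
  exact ⟨{ toFun := L
           map_add' := fun a b => ext_inner_left ℝ fun y => by simp [hL, inner_add_right]
           map_smul' := fun c a => ext_inner_left ℝ fun y => by simp [hL, inner_smul_right] },
    fun a y => hL a y⟩

/-- The Fourier transform between complementary Lagrangian subspaces preserves Schwartz
functions. -/
theorem exists_schwartz_fourier [MeasurableSpace T] [BorelSpace T] {h : ℝ} (hh : h ≠ 0)
    {A B : Lagrangian ω} (hAB : Compl A B) (μ : Measure B) [μ.IsAddHaarMeasure] (f : 𝓢(B, ℂ)) :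
    ∃ f' : 𝓢(A, ℂ), ∀ a : A, f' a = ∫ b : B, eh h (ω a b) * f b ∂μ := by
  let E := EuclideanSpace ℝ (Fin (Module.finrank ℝ B))
  let e : B ≃L[ℝ] E := toEuclidean
  obtain ⟨L, hLφ⟩ : ∃ L : A →ₗ[ℝ] E, ∀ a y, inner ℝ y (L a) = -h * ω a (e.symm y) := by
    obtain ⟨L, hL⟩ := exists_riesz (E := E) (((-h) • ω.form).compl₁₂ A.toSubmodule.subtype
      (B.toSubmodule.subtype ∘ₗ (e.symm : E →ₗ[ℝ] B)))
    exact ⟨L, fun a y => by rw [hL]; simp⟩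
  have hL : Function.Injective L := by
    rw [← LinearMap.ker_eq_bot, LinearMap.ker_eq_bot']
    intro a ha
    ext
    refine ω.nondegenerate _ fun z => ?_
    have h1 := hLφ a (e ⟨proj hAB.symm z, proj_mem _ _⟩)
    rw [ha] at h1
    have h2 : ω a (proj hAB.symm z) = 0 := by simpa [hh] using h1
    rw [← proj_add_proj hAB z, map_add, h2, A.isotropic a.2 (proj_mem _ _), add_zero]
  obtain ⟨k, -, hk⟩ := L.exists_antilipschitzWith (LinearMap.ker_eq_bot.2 hL)
  let f₁ : 𝓢(E, ℂ) := SchwartzMap.compCLMOfContinuousLinearEquiv ℂ e.symm f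
  have : (μ.map e).IsAddHaarMeasure := e.isAddHaarMeasure_map μ
  let c := Measure.addHaarScalarFactor (μ.map e) volume
  have hc : μ.map e = c • volume := Measure.isAddLeftInvariant_eq_smul _ _
  have hLt : (L : A → E).HasTemperateGrowth :=
    ContinuousLinearMap.hasTemperateGrowth L.toContinuousLinearMap
  refine ⟨(c : ℂ) • SchwartzMap.compCLMOfAntilipschitz ℂ hLt hk
      (FourierTransform.fourier f₁), fun a => ?_⟩
  have h1 : ∫ b : B, eh h (ω a b) * f b ∂μ
      = ∫ y : E, eh h (ω a (e.symm y)) * f (e.symm y) ∂(μ.map e) := by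
    rw [show (e : B → E) = e.toHomeomorph from rfl,
      e.toHomeomorph.measurableEmbedding.integral_map]
    simp
  have h2 : FourierTransform.fourier (f₁ : E → ℂ) (L a)
      = ∫ y : E, eh h (ω a (e.symm y)) * f (e.symm y) := by
    rw [Real.fourier_eq']
    refine integral_congr_ae (Filter.Eventually.of_forall fun y => ?_)
    simp only [hLφ, eh, f₁, smul_eq_mul, SchwartzMap.compCLMOfContinuousLinearEquiv_apply,
      Function.comp]
    congr 2
    push_cast
    ring
  rw [h1, hc, integral_smul_nnreal_measure, ← h2, NNReal.smul_def, Complex.real_smul]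
  rfl

/-- The functions on the Heisenberg group that transform under the centre by `e_h` and are
invariant under right translation by `A`, and whose restriction to every Lagrangian complement
of `A` is a Schwartz function. -/
def InvSchwartz (h : ℝ) (A : Lagrangian ω) : Submodule ℂ (Heisenberg ω → ℂ) where
  carrier := {ψ | (∀ c g, ψ (⟨c, 0⟩ * g) = eh h c * ψ g) ∧
    (∀ a ∈ Heisenberg.ofLagrangian A, ∀ g, ψ (g * a) = ψ g) ∧
    ∀ B : Lagrangian ω, Compl A B → ∃ f : 𝓢(B, ℂ), ∀ x : B, f x = ψ ⟨0, x⟩}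
  add_mem' := by
    rintro ψ ψ' ⟨h1, h2, h3⟩ ⟨h1', h2', h3'⟩
    refine ⟨fun c g => by simp [h1, h1', mul_add], fun a ha g => by simp [h2 a ha, h2' a ha],
      fun B hB => ?_⟩
    obtain ⟨f, hf⟩ := h3 B hB
    obtain ⟨f', hf'⟩ := h3' B hB
    exact ⟨f + f', fun x => by simp [hf, hf']⟩
  zero_mem' := ⟨by simp, by simp, fun B _ => ⟨0, by simp⟩⟩
  smul_mem' := by
    rintro c ψ ⟨h1, h2, h3⟩
    refine ⟨fun d g => by simp [h1]; ring, fun a ha g => by simp [h2 a ha], fun B hB => ?_⟩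
    obtain ⟨f, hf⟩ := h3 B hB
    exact ⟨c • f, fun x => by simp [hf]⟩

/-- An equivariant, right `A`-invariant function is determined by its restriction to a
complement of `A`. -/
theorem apply_eq_of_invariant {h : ℝ} {A B : Lagrangian ω} (hAB : Compl A B)
    {ψ : Heisenberg ω → ℂ} (h1 : ∀ c g, ψ (⟨c, 0⟩ * g) = eh h c * ψ g)
    (h2 : ∀ a ∈ Heisenberg.ofLagrangian A, ∀ g, ψ (g * a) = ψ g) (g : Heisenberg ω) :
    ψ g = eh h (g.t - ω (proj hAB.symm g.z) (proj hAB g.z) / 2) *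
      ψ ⟨0, proj hAB.symm g.z⟩ := by
  rw [← h1, ← h2 ⟨0, proj hAB g.z⟩ ⟨rfl, proj_mem _ _⟩ (_ * _)]
  congr 1
  ext
  · simp
  · simp [add_comm (proj hAB.symm g.z), proj_add_proj]

/-- Schwartz decay along one complement implies it along every complement. -/
theorem mem_invSchwartz {h : ℝ} {A B : Lagrangian ω} (hAB : Compl A B)
    {ψ : Heisenberg ω → ℂ} (h1 : ∀ c g, ψ (⟨c, 0⟩ * g) = eh h c * ψ g)
    (h2 : ∀ a ∈ Heisenberg.ofLagrangian A, ∀ g, ψ (g * a) = ψ g)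
    (h3 : ∃ f : 𝓢(B, ℂ), ∀ x : B, f x = ψ ⟨0, x⟩) : ψ ∈ InvSchwartz h A := by
  refine ⟨h1, h2, fun B' hAB' => ?_⟩
  obtain ⟨f, hf⟩ := h3
  let L : B' →ₗ[ℝ] B := (B.toSubmodule.projectionOnto A.toSubmodule hAB.symm) ∘ₗ
    B'.toSubmodule.subtype
  have hL : Function.Injective L := by
    rw [← LinearMap.ker_eq_bot, LinearMap.ker_eq_bot']
    intro x hx
    have h4 : (x : T) ∈ A.toSubmodule :=
      (Submodule.projectionOnto_apply_eq_zero_iff (IsCompl.symm hAB)).1 hx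
    exact Subtype.ext ((Submodule.disjoint_def.1 hAB'.disjoint) _ h4 x.2)
  obtain ⟨f', hf'⟩ := exists_schwartz_quadratic ω h L hL
    (proj hAB.symm ∘ₗ B'.toSubmodule.subtype)
    ((-(1 / 2) : ℝ) • (proj hAB ∘ₗ B'.toSubmodule.subtype)) f
  refine ⟨f', fun x => ?_⟩
  rw [hf', apply_eq_of_invariant hAB h1 h2, hf]
  congr 2
  simp
  ring

/-- The induction map `ind` from Schwartz functions on `X` to right `A`-invariant functions:
`(ind f)(t, z) = e_h(t - ω([X A]₊ z, z) / 2) f([X A]₊ z)`. -/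
def ind (h : ℝ) {A X : Lagrangian ω} (hAX : Compl A X) : 𝓢(X, ℂ) →ₗ[ℂ] InvSchwartz h A where
  toFun f := ⟨fun g => eh h (g.t - ω (proj hAX.symm g.z) g.z / 2) *
      f ⟨proj hAX.symm g.z, proj_mem _ _⟩, by
    refine mem_invSchwartz hAX (fun c g => ?_) (fun a ha g => ?_) ⟨f, fun x => ?_⟩
    · simp only [Heisenberg.mul_t, Heisenberg.mul_z, zero_add, map_zero, LinearMap.zero_apply,
        zero_div, add_zero, ← mul_assoc, ← eh_add]
      congr 2
      ring
    · obtain ⟨ha, ha'⟩ := ha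
      have h1 : proj hAX.symm (g * a).z = proj hAX.symm g.z := by
        simp [proj_of_mem_right hAX.symm ha']
      have h2 : ω g.z a.z = ω (proj hAX.symm g.z) a.z := by
        conv_lhs => rw [← proj_add_proj hAX g.z]
        simp [A.isotropic (proj_mem hAX g.z) ha']
      simp only [h1]
      simp only [Heisenberg.mul_t, Heisenberg.mul_z, ha, h2, map_add]
      congr 2
      ring
    · simp [proj_of_mem hAX.symm x.2, ω.alt, eh_zero]⟩
  map_add' f f' := by ext g; simp [mul_add]
  map_smul' c f := by ext g; simp; ring

/-- Restriction of a right `A`-invariant function to a complementary Lagrangian subspace `X`. -/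
def res {h : ℝ} {A X : Lagrangian ω} (hAX : Compl A X) : InvSchwartz h A →ₗ[ℂ] 𝓢(X, ℂ) where
  toFun ψ := (ψ.2.2.2 X hAX).choose
  map_add' ψ ψ' := by
    ext x
    rw [add_apply, (ψ.2.2.2 X hAX).choose_spec, (ψ'.2.2.2 X hAX).choose_spec,
      ((ψ + ψ').2.2.2 X hAX).choose_spec]
    rfl
  map_smul' c ψ := by
    ext x
    rw [RingHom.id_apply, smul_apply, (ψ.2.2.2 X hAX).choose_spec,
      ((c • ψ).2.2.2 X hAX).choose_spec]
    rfl

theorem res_apply {h : ℝ} {A X : Lagrangian ω} (hAX : Compl A X) (ψ : InvSchwartz h A) (x : X) :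
    res hAX ψ x = ψ.1 ⟨0, x⟩ := (ψ.2.2.2 X hAX).choose_spec x

variable [MeasurableSpace T] [BorelSpace T]

theorem integrable_translate {h : ℝ} {A B : Lagrangian ω} (hAB : Compl A B) (μ : Measure B)
    [μ.IsAddHaarMeasure] (ψ : InvSchwartz h A) (g : Heisenberg ω) :
    Integrable (fun b : B => ψ.1 (g * ⟨0, b⟩)) μ := by
  obtain ⟨f, hf⟩ := ψ.2.2.2 B hAB
  have h1 : ∀ b : B, ψ.1 (g * ⟨0, b⟩) =
      eh h (g.t + ω g.z b / 2 - ω (proj hAB.symm g.z + b) (proj hAB g.z) / 2) *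
        f (⟨proj hAB.symm g.z, proj_mem _ _⟩ + b) := by
    intro b
    rw [apply_eq_of_invariant hAB ψ.2.1 ψ.2.2.1, hf]
    simp [proj_of_mem hAB.symm b.2, proj_of_mem_right hAB b.2]
  simp only [h1]
  refine ((f.integrable (μ := μ)).comp_add_left _).bdd_mul (c := 1) ?_ ?_
  · refine Continuous.aestronglyMeasurable ((continuous_eh h).comp ?_)
    have h2 : Continuous fun b : B => ω g.z b :=
      (LinearMap.continuous_of_finiteDimensional (ω.form g.z)).comp continuous_subtype_val
    have h3 : Continuous fun b : B => ω (proj hAB.symm g.z + b) (proj hAB g.z) :=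
      (LinearMap.continuous_of_finiteDimensional (ω.form.flip (proj hAB g.z))).comp
        (continuous_const.add continuous_subtype_val)
    fun_prop
  · exact Filter.Eventually.of_forall fun b => (norm_eh _ _).le

/-- Convolution with the Lagrangian distribution `δ_B` for the Haar measure `μ` on `B`, that is,
averaging over right translations by `B`: `(δ_B * ψ)(g) = ∫_B ψ(g · (0, b)) dμ(b)`. It maps right
`A`-invariant functions to right `B`-invariant functions. -/
def deltaConv {h : ℝ} (hh : h ≠ 0) {A B : Lagrangian ω} (hAB : Compl A B) (μ : Measure B)
    [μ.IsAddHaarMeasure] : InvSchwartz h A →ₗ[ℂ] InvSchwartz h B where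
  toFun ψ := ⟨fun g => ∫ b : B, ψ.1 (g * ⟨0, b⟩) ∂μ, by
    refine mem_invSchwartz hAB.symm (fun c g => ?_) (fun a ha g => ?_) ?_
    · simp only [mul_assoc, ψ.2.1]
      exact integral_const_mul _ _
    · obtain ⟨ha, ha'⟩ := ha
      rw [← integral_add_left_eq_self (μ := μ) (fun b : B => ψ.1 (g * ⟨0, b⟩)) ⟨a.z, ha'⟩]
      congr 1
      funext b
      rw [mul_assoc]
      refine congrArg (fun k => ψ.1 (g * k)) ?_
      ext
      · simp [ha, B.isotropic ha' b.2]
      · simp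
    · obtain ⟨f, hf⟩ := ψ.2.2.2 B hAB
      obtain ⟨f', hf'⟩ := exists_schwartz_fourier hh hAB μ f
      refine ⟨f', fun a => ?_⟩
      rw [hf']
      congr 1
      funext b
      rw [apply_eq_of_invariant hAB ψ.2.1 ψ.2.2.1, hf]
      simp only [Heisenberg.mul_t, Heisenberg.mul_z, map_add, proj_of_mem hAB a.2,
        proj_of_mem_right hAB b.2, proj_of_mem hAB.symm b.2, proj_of_mem_right hAB.symm a.2,
        zero_add, add_zero, ← ω.neg_eq (a : T) (b : T)]
      congr 2
      ring⟩
  map_add' ψ ψ' := by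
    ext g
    exact integral_add (integrable_translate hAB μ ψ g) (integrable_translate hAB μ ψ' g)
  map_smul' c ψ := by
    ext g
    exact integral_const_mul _ _

/-- The Liouville measure of a symplectic vector space: the Haar measure giving mass
`|det (ω(bᵢ, bⱼ))|^(1/2)` to the parallelepiped spanned by a basis `b`. -/
def SymplecticForm.liouville (ω : SymplecticForm T) : Measure T :=
  NNReal.sqrt ‖(Matrix.of fun i j => ω (Module.finBasis ℝ T i) (Module.finBasis ℝ T j)).det‖₊ •
    (Module.finBasis ℝ T).addHaar

instance (ω : SymplecticForm T) : ω.liouville.IsAddHaarMeasure := by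
  have h1 : (Matrix.of fun i j =>
      ω (Module.finBasis ℝ T i) (Module.finBasis ℝ T j)).det ≠ 0 := by
    intro h0
    obtain ⟨v, hv, hv'⟩ := Matrix.exists_vecMul_eq_zero_iff.2 h0
    refine hv ?_
    have h2 : ∑ i, v i • Module.finBasis ℝ T i = 0 := by
      refine ω.nondegenerate _ fun y => ?_
      have h3 : ω.form (∑ i, v i • Module.finBasis ℝ T i) = 0 :=
        (Module.finBasis ℝ T).ext fun j => by
          simpa [Matrix.vecMul, dotProduct] using congrFun hv' j
      rw [h3, LinearMap.zero_apply]
    funext i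
    exact Fintype.linearIndependent_iff.1 (Module.finBasis ℝ T).linearIndependent v h2 i
  exact Measure.IsAddHaarMeasure.nnreal_smul _ (by simpa using h1)

/-- The constant Radon--Nikodym derivative `dμ_A dμ_B / dL` of the product measure on
`T = A ⊕ B` with respect to the Liouville measure. -/
def relDensity {A B : Lagrangian ω} (hAB : Compl A B) (μA : Measure A) [μA.IsAddHaarMeasure]
    (μB : Measure B) [μB.IsAddHaarMeasure] : ℝ≥0 :=
  have := (Submodule.prodEquivOfIsCompl _ _ hAB).toContinuousLinearEquiv.isAddHaarMeasure_map
    (μA.prod μB)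
  Measure.addHaarScalarFactor
    ((μA.prod μB).map (Submodule.prodEquivOfIsCompl _ _ hAB).toContinuousLinearEquiv) ω.liouville

theorem relDensity_pos {A B : Lagrangian ω} (hAB : Compl A B) (μA : Measure A)
    [μA.IsAddHaarMeasure] (μB : Measure B) [μB.IsAddHaarMeasure] : 0 < relDensity hAB μA μB :=
  have := (Submodule.prodEquivOfIsCompl _ _ hAB).toContinuousLinearEquiv.isAddHaarMeasure_map
    (μA.prod μB)
  Measure.addHaarScalarFactor_pos_of_isAddHaarMeasure _ _

/-- The self-dual Haar measure `d_h` on `B` relative to `A`: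
`d_h b = |h|^(n/2) (dμ_A dμ_B / dL)^(-1/2) dμ_B(b)`. This is the multiple of `μ_B` for which the
Fourier transform `δ_B *` from right `A`-invariant to right `B`-invariant functions is unitary. -/
def selfDual (h : ℝ) {A B : Lagrangian ω} (hAB : Compl A B) (μA : Measure A)
    [μA.IsAddHaarMeasure] (μB : Measure B) [μB.IsAddHaarMeasure] : Measure B :=
  NNReal.sqrt (‖h‖₊ ^ Module.finrank ℝ B / relDensity hAB μA μB) • μB

theorem isAddHaarMeasure_selfDual {h : ℝ} (hh : h ≠ 0) {A B : Lagrangian ω} (hAB : Compl A B)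
    (μA : Measure A) [μA.IsAddHaarMeasure] (μB : Measure B) [μB.IsAddHaarMeasure] :
    (selfDual h hAB μA μB).IsAddHaarMeasure :=
  Measure.IsAddHaarMeasure.nnreal_smul _ (by
    have := (relDensity_pos hAB μA μB).ne'
    simp [this, hh])

/-- The Fourier transform `δ_B *`, taken with the self-dual Haar measure on `B` relative
to `A`. -/
def fourier {h : ℝ} (hh : h ≠ 0) {A B : Lagrangian ω} (hAB : Compl A B) (μA : Measure A)
    [μA.IsAddHaarMeasure] (μB : Measure B) [μB.IsAddHaarMeasure] :
    InvSchwartz h A →ₗ[ℂ] InvSchwartz h B :=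
  have := isAddHaarMeasure_selfDual hh hAB μA μB
  deltaConv hh hAB (selfDual h hAB μA μB)

/-- A positive Lagrangian curve: in the affine chart of the Lagrangian Grassmannian given by
`H(t)` and any Lagrangian complement `X`, where `H(u)` near `u = t` is the graph of a symmetric map
`S(u) : H(t) → X`, the curve is differentiable at `t` with positive-definite derivative. -/
def IsPositiveCurve (U : Set ℝ) (H : ℝ → Lagrangian ω) : Prop :=
  ∀ t ∈ U, ∀ X : Lagrangian ω, Compl (H t) X →
    ∃ (S : ℝ → (H t →L[ℝ] X)) (S' : H t →L[ℝ] X),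
      (∀ᶠ u in 𝓝[U] t, ∀ z : T, z ∈ (H u).toSubmodule ↔ ∃ v : H t, z = S u v + v) ∧
      HasDerivWithinAt S S' U t ∧ ∀ v : H t, v ≠ 0 → 0 < ω (S' v) v

/-- The plane wave of a Lagrangian curve `H` over `U`: the wave front at `u` is the homogeneous
space of the Heisenberg group by the stabilizer `H(u)`. -/
abbrev Spacetime (U : Set ℝ) (H : ℝ → Lagrangian ω) : Type _ :=
  Σ u : U, Heisenberg ω ⧸ Heisenberg.ofLagrangian (H u)

/-- The central null geodesic. -/
def centralGeodesic {U : Set ℝ} {H : ℝ → Lagrangian ω} (u : U) : Spacetime U H :=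
  ⟨u, ((1 : Heisenberg ω) : Heisenberg ω ⧸ Heisenberg.ofLagrangian (H u))⟩

/-- A field bundle on the plane wave: complex vector spaces over the points, a linear action of
the Heisenberg group covering its action on the plane wave, and a parallel transport along the
central null geodesic. -/
structure FieldBundle (U : Set ℝ) (H : ℝ → Lagrangian ω) where
  fiber : Spacetime U H → Type*
  [addCommGroup : ∀ p, AddCommGroup (fiber p)]
  [module : ∀ p, Module ℂ (fiber p)]
  act : ∀ (g : Heisenberg ω) (p : Spacetime U H), fiber p →ₗ[ℂ] fiber (g • p)
  act_one : ∀ p (e : fiber p),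
    (⟨(1 : Heisenberg ω) • p, act 1 p e⟩ : Σ p, fiber p) = ⟨p, e⟩
  act_mul : ∀ g g' p (e : fiber p),
    (⟨(g * g') • p, act (g * g') p e⟩ : Σ p, fiber p) =
      ⟨g • g' • p, act g (g' • p) (act g' p e)⟩
  transport : ∀ s t : U, fiber (centralGeodesic s) →ₗ[ℂ] fiber (centralGeodesic t)
  transport_self : ∀ s, transport s s = LinearMap.id
  transport_trans : ∀ r s t, transport s t ∘ₗ transport r s = transport r t

attribute [instance] FieldBundle.addCommGroup FieldBundle.module

/-- The fibre `𝔉(u)` of a field bundle on the central null geodesic. -/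
abbrev FieldBundle.at {U : Set ℝ} {H : ℝ → Lagrangian ω} (F : FieldBundle U H) (u : U) : Type _ :=
  F.fiber (centralGeodesic u)

/-- The Schrödinger evolution `Φ_X(s, u)`: the composition of `ind`, `δ_X *`, the parallel
transport from `s` to `u`, `δ_{H(u)} *` and the restriction to `X`. -/
def evolution {h : ℝ} (hh : h ≠ 0) {U : Set ℝ} {H : ℝ → Lagrangian ω} (F : FieldBundle U H)
    (ν : ∀ u : U, Measure (H u)) [∀ u, (ν u).IsAddHaarMeasure] {X : Lagrangian ω}
    (μ : Measure X) [μ.IsAddHaarMeasure] (hX : ∀ u : U, Compl (H u) X) (s u : U) :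
    𝓢(X, ℂ) ⊗[ℂ] F.at s →ₗ[ℂ] 𝓢(X, ℂ) ⊗[ℂ] F.at u :=
  (res (hX u)).rTensor (F.at u) ∘ₗ
  (fourier hh (hX u).symm μ (ν u)).rTensor (F.at u) ∘ₗ
  (F.transport s u).lTensor (InvSchwartz h X) ∘ₗ
  (fourier hh (hX s) (ν s) μ).rTensor (F.at s) ∘ₗ
  (ind h (hX s)).rTensor (F.at s)

end Analysis

/-- A linear operator is positive-definite: `⟨x, A x⟩ > 0` for all `x ≠ 0`, with respect to some
inner product. -/
def IsPosDefOperator {E : Type*} [AddCommGroup E] [Module ℝ E] (A : E →ₗ[ℝ] E) : Prop :=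
  ∃ B : LinearMap.BilinForm ℝ E, (∀ x y, B x y = B y x) ∧ (∀ x, x ≠ 0 → 0 < B x x) ∧
    ∀ x, x ≠ 0 → 0 < B x (A x)

end PlaneWave

end

/-!
The map `ρ_u` is `res_{X'} ∘ ind_X`: it compares the restrictions to `X` and to `X'` of one and the
same right `H(u)`-invariant function (`changeComplement`). Since `ind` and `res` are inverse to
each other, this gives at once the two explicit formulas, and it reduces the intertwining relation
to the statement that the composite `δ_C * δ_X *`, from right `A`-invariant to right `C`-invariant
functions with `A = H(s)` and `C = H(u)`, is the same for `X` and for `X'` (`fourier_fourier_eq`).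

Choose linear coordinates of `A` and of `X` that are dual to each other for `h ω`, and let `k`, `y`
be the matrices of `K_u` and `Y`. They are symmetric because graphs are isotropic. Write
`e(t) = exp (2 π i t)` and `F` for the Fourier transform. With `f` the restriction of a function to
`X`, the composite through `X` becomes the Fourier multiplier `F⁻¹ e(-v · k v / 2) F`, up to a
shift, and the one through `X'` becomes `F⁻¹ e(-v · k' v / 2) F e(p · y p / 2)` with
`k' = k (1 - y k)⁻¹` (`fourier_apply_coordinates`, `fourier_apply_graph`). That they agree up to the
factor `det (1 - y k) ^ (1 / 2)` is `oscInt_mobius`; the self-dual normalization of the measures,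
together with the Jacobian of the coordinate change on `C`, contributes exactly the inverse factor
(`coordDensity_graph`, `sqrt_constants`).

The analytic point is the sign of that square root. Replace `k` by `κ = k - i ε`, and `k'` by
`κ' = κ (1 - y κ)⁻¹`, whose imaginary part is again negative definite (`im_star_dotProduct_mobius`).
Now everything converges absolutely, Fubini's theorem turns both operators into integral operators
with Gaussian kernels (`oscInt_eq_of_damped`, `gaussInt_eq`), and the kernels agree because
`κ'⁻¹ = κ⁻¹ - y`, up to the ratio of the total Gaussian integrals of `κ'` and `κ`. The square of
this ratio is `det (1 - y κ)`. Positivity of `1 - y k` keeps `det (1 - r y k)` positive for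
`0 ≤ r ≤ 1` (`det_pos_of_isPosDefOperator`), so for small `ε` the determinants `det (1 - r y κ)`
avoid the negative axis; deforming `y` to `0` through the matrices `r y` shows that the ratio is the
principal square root (`gaussInt_mobius`). Dominated convergence gives the result for `ε → 0`.
-/

noncomputable section

namespace PlaneWave

open Matrix

section Gaussian

open Complex

variable {ι : Type*} [Fintype ι] [DecidableEq ι]

/-! ### Gaussian integrals with complex symmetric exponents -/

/-- The complexification of a real coordinate vector. -/
def cvec (v : ι → ℝ) : ι → ℂ := fun i => (v i : ℂ)

/-- The quadratic form `vᵀ κ v` of a complex matrix, evaluated at a real vector. -/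
def quad (κ : Matrix ι ι ℂ) (v : ι → ℝ) : ℂ := cvec v ⬝ᵥ κ *ᵥ cvec v

/-- `e(z) = exp (2 π i z)`, for complex `z`. -/
def phase (z : ℂ) : ℂ := cexp (2 * Real.pi * I * z)

theorem phase_add (z w : ℂ) : phase (z + w) = phase z * phase w := by
  simp only [phase, mul_add, Complex.exp_add]

theorem phase_zero : phase 0 = 1 := by simp [phase]

theorem norm_phase (z : ℂ) : ‖phase z‖ = Real.exp (-(2 * Real.pi * z.im)) := by
  rw [phase, Complex.norm_exp]
  simp

theorem norm_phase_ofReal (t : ℝ) : ‖phase t‖ = 1 := by simp [norm_phase]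

theorem continuous_phase : Continuous phase := by unfold phase; fun_prop

theorem cvec_dotProduct_cvec (v w : ι → ℝ) : cvec v ⬝ᵥ cvec w = ((v ⬝ᵥ w : ℝ) : ℂ) := by
  simp [dotProduct, cvec]

theorem cvec_mulVec (M : Matrix ι ι ℝ) (v : ι → ℝ) :
    cvec (M *ᵥ v) = M.map ofReal *ᵥ cvec v := by
  ext i
  simp [cvec, mulVec, dotProduct]

theorem continuous_cvec : Continuous (cvec : (ι → ℝ) → ι → ℂ) := by unfold cvec; fun_prop

theorem continuous_quad (κ : Matrix ι ι ℂ) : Continuous (quad κ) := by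
  have := continuous_cvec (ι := ι)
  unfold quad
  simp only [dotProduct, mulVec]
  fun_prop

theorem quad_im (κ : Matrix ι ι ℂ) (v : ι → ℝ) : (quad κ v).im = v ⬝ᵥ κ.map im *ᵥ v := by
  simp [quad, cvec, dotProduct, mulVec]

theorem quad_mulVec (κ : Matrix ι ι ℂ) (M : Matrix ι ι ℝ) (v : ι → ℝ) :
    quad κ (M *ᵥ v) = quad ((M.map ofReal)ᵀ * κ * M.map ofReal) v := by
  simp only [quad, cvec_mulVec]
  rw [dotProduct_mulVec, vecMul_mulVec, ← dotProduct_mulVec, mulVec_mulVec, Matrix.mul_assoc]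

theorem det_map_ofReal (M : Matrix ι ι ℝ) : (M.map ofReal : Matrix ι ι ℂ).det = (M.det : ℝ) :=
  (RingHom.map_det ofRealHom M).symm

theorem cpow_half_sq (z : ℂ) : (z ^ (1 / 2 : ℂ)) ^ 2 = z := by
  rw [one_div (2 : ℂ)]
  exact_mod_cast Complex.cpow_nat_inv_pow z two_ne_zero

theorem exists_orthogonal_diagonal {S : Matrix ι ι ℝ} (hS : Sᵀ = S) :
    ∃ (O : Matrix ι ι ℝ) (d : ι → ℝ), Oᵀ * O = 1 ∧ Oᵀ * S * O = diagonal d := by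
  have hS' : S.IsHermitian := by rw [IsHermitian, conjTranspose_eq_transpose_of_trivial, hS]
  refine ⟨hS'.eigenvectorUnitary, hS'.eigenvalues, ?_, ?_⟩
  · have := Unitary.coe_star_mul_self hS'.eigenvectorUnitary
    rwa [star_eq_conjTranspose, conjTranspose_eq_transpose_of_trivial] at this
  · have := hS'.conjStarAlgAut_star_eigenvectorUnitary
    rw [Unitary.conjStarAlgAut_star_apply, star_eq_conjTranspose,
      conjTranspose_eq_transpose_of_trivial] at this
    exact this

/-- Simultaneous diagonalization by congruence of the real and the imaginary part of a complex
symmetric matrix whose imaginary part is negative definite. -/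
theorem exists_congruent_diagonal {κ : Matrix ι ι ℂ} (hs : κᵀ = κ)
    (him : ∀ v : ι → ℝ, v ≠ 0 → (quad κ v).im < 0) :
    ∃ (P : Matrix ι ι ℝ) (d : ι → ℂ), P.det ≠ 0 ∧ (∀ i, (d i).im < 0) ∧
      (P.map ofReal)ᵀ * κ * P.map ofReal = diagonal d := by
  have hsym : ∀ i j, κ i j = κ j i := fun i j => congrFun (congrFun hs.symm i) j
  obtain ⟨O, d, hO, hd⟩ := exists_orthogonal_diagonal (S := κ.map im) (by
    ext i j; simp [hsym i j])
  have hneg : ∀ i, d i < 0 := by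
    intro i
    have h1 : O *ᵥ Pi.single i 1 ≠ 0 := by
      intro h0
      have h2 : (Oᵀ * O) *ᵥ (Pi.single i (1 : ℝ)) = 0 := by rw [← mulVec_mulVec, h0, mulVec_zero]
      rw [hO, one_mulVec] at h2
      simpa using congrFun h2 i
    have h3 := him _ h1
    rw [quad_im, dotProduct_mulVec, vecMul_mulVec, ← dotProduct_mulVec, mulVec_mulVec,
      hd] at h3
    simpa [mulVec_diagonal] using h3
  -- `P₁` normalizes the imaginary part to `-1`; the real part can then be diagonalized by an
  -- orthogonal matrix without disturbing it.
  let P₁ : Matrix ι ι ℝ := O * diagonal fun i => (Real.sqrt (-d i))⁻¹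
  have hsq : ∀ i, Real.sqrt (-d i) * Real.sqrt (-d i) = -d i := fun i =>
    Real.mul_self_sqrt (by linarith [hneg i])
  have hsq0 : ∀ i, Real.sqrt (-d i) ≠ 0 := fun i => (Real.sqrt_pos.2 (by linarith [hneg i])).ne'
  have hP₁ : P₁ᵀ * κ.map im * P₁ = -1 := by
    have : P₁ᵀ * κ.map im * P₁ = diagonal (fun i => (Real.sqrt (-d i))⁻¹) *
        (Oᵀ * κ.map im * O) * diagonal fun i => (Real.sqrt (-d i))⁻¹ := by
      simp only [P₁, transpose_mul, diagonal_transpose, Matrix.mul_assoc]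
    rw [this, hd, diagonal_mul_diagonal, diagonal_mul_diagonal, ← diagonal_one, diagonal_neg]
    congr 1
    funext i
    have h1 := hsq i
    have h2 := hsq0 i
    field_simp
    linarith
  obtain ⟨Q, e, hQ, he⟩ := exists_orthogonal_diagonal (S := P₁ᵀ * κ.map re * P₁) (by
    have : (κ.map re)ᵀ = κ.map re := by ext i j; simp [hsym i j]
    rw [transpose_mul _ P₁, transpose_mul P₁ᵀ, transpose_transpose, this, Matrix.mul_assoc])
  have hre : (P₁ * Q)ᵀ * κ.map re * (P₁ * Q) = diagonal e := by
    rw [← he, transpose_mul]; simp only [Matrix.mul_assoc]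
  have hi : (P₁ * Q)ᵀ * κ.map im * (P₁ * Q) = -1 := by
    have : (P₁ * Q)ᵀ * κ.map im * (P₁ * Q) = Qᵀ * (P₁ᵀ * κ.map im * P₁) * Q := by
      rw [transpose_mul]; simp only [Matrix.mul_assoc]
    rw [this, hP₁]
    simp [hQ]
  refine ⟨P₁ * Q, fun i => e i - I, ?_, fun i => by simp, ?_⟩
  · have h1 := congrArg det hi
    intro h0
    rw [det_mul, h0, mul_zero, det_neg, det_one, mul_one] at h1
    exact pow_ne_zero _ (by norm_num) h1.symm
  · have h1 : κ = (κ.map re).map ofReal + I • (κ.map im).map ofReal := by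
      ext i j
      simp [mul_comm I, re_add_im]
    have h2 : ∀ N : Matrix ι ι ℝ, ((P₁ * Q).map ofReal)ᵀ * N.map ofReal * (P₁ * Q).map ofReal =
        ((P₁ * Q)ᵀ * N * (P₁ * Q)).map ofReal := fun N => by
      have h3 : ∀ A B : Matrix ι ι ℝ, (A * B).map ofReal = A.map ofReal * B.map ofReal :=
        fun A B => Matrix.map_mul (f := ofRealHom)
      rw [h3 _ (P₁ * Q), h3 _ N]; rfl
    conv_lhs => rw [h1]
    rw [Matrix.mul_add, Matrix.add_mul, Matrix.mul_smul, Matrix.smul_mul, h2, h2, hre, hi]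
    ext i j
    by_cases hij : i = j
    · subst hij; simp; ring
    · simp [hij]

/-- The Gaussian integral `∫ e(b · v - vᵀ κ v / 2) dv`; it converges absolutely if the imaginary
part of `κ` is negative definite. -/
def gaussInt (κ : Matrix ι ι ℂ) (b : ι → ℝ) : ℂ :=
  ∫ v : ι → ℝ, phase ((b ⬝ᵥ v : ℝ) - 1 / 2 * quad κ v)

/-- The linear change of variables `v = P w` in Lebesgue measure. -/
theorem integral_mulVec {P : Matrix ι ι ℝ} (hP : P.det ≠ 0) (f : (ι → ℝ) → ℂ) :
    ∫ v, f v = (|P.det| : ℝ) * ∫ v, f (P *ᵥ v) := by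
  have h1 := Real.map_matrix_volume_pi_eq_smul_volume_pi hP
  let e := (LinearEquiv.ofIsUnitDet (f := Matrix.toLin' P) (v := Pi.basisFun ℝ ι)
    (v' := Pi.basisFun ℝ ι)
    (by simpa [LinearMap.toMatrix_eq_toMatrix'] using hP)).toContinuousLinearEquiv
  have h2 : ∫ v, f (P *ᵥ v) = ∫ v, f v ∂(Measure.map (Matrix.toLin' P) volume) := by
    have : (Matrix.toLin' P : (ι → ℝ) → ι → ℝ) = e.toHomeomorph := rfl
    rw [this, e.toHomeomorph.measurableEmbedding.integral_map]
    rfl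
  rw [h2, h1, integral_smul_measure, ENNReal.toReal_ofReal (abs_nonneg _), Complex.real_smul,
    ← mul_assoc, ← ofReal_mul, ← abs_mul, mul_inv_cancel₀ hP]
  simp

theorem quad_diagonal (d : ι → ℂ) (v : ι → ℝ) :
    quad (diagonal d) v = ∑ i, d i * (v i : ℂ) ^ 2 := by
  simp only [quad, dotProduct, mulVec_diagonal, cvec]
  exact Finset.sum_congr rfl fun i _ => by ring

/-- The value of the Gaussian integral in a basis that diagonalizes the exponent. -/
theorem gaussInt_of_congruent {κ : Matrix ι ι ℂ} {P : Matrix ι ι ℝ} {d : ι → ℂ} (hP : P.det ≠ 0)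
    (hd : ∀ i, (d i).im < 0) (h : (P.map ofReal)ᵀ * κ * P.map ofReal = diagonal d) (b : ι → ℝ) :
    gaussInt κ b = (|P.det| : ℝ) * ((∏ i, (1 / (I * d i)) ^ (1 / 2 : ℂ)) *
      phase (1 / 2 * ∑ i, ((Pᵀ *ᵥ b) i : ℂ) ^ 2 / d i)) := by
  have hd0 : ∀ i, d i ≠ 0 := fun i h0 => by simpa [h0] using hd i
  have hpi : (Real.pi : ℂ) ≠ 0 := by exact_mod_cast Real.pi_ne_zero
  have h2 : ∀ v : ι → ℝ, phase ((b ⬝ᵥ P *ᵥ v : ℝ) - 1 / 2 * quad κ (P *ᵥ v)) =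
      cexp (-∑ i, (Real.pi * I * d i) * (v i : ℂ) ^ 2 +
        ∑ i, (2 * Real.pi * I * ((Pᵀ *ᵥ b) i : ℂ)) * v i) := fun v => by
    rw [quad_mulVec, h, quad_diagonal, dotProduct_mulVec, ← mulVec_transpose, phase]
    congr 1
    simp only [dotProduct, ofReal_sum, ofReal_mul, mul_sub, Finset.mul_sum, mul_assoc]
    rw [neg_add_eq_sub]
    congr 1
    exact Finset.sum_congr rfl fun i _ => by ring
  rw [gaussInt, integral_mulVec hP]
  congr 1
  simp only [h2]
  rw [GaussianFourier.integral_cexp_neg_sum_mul_add (fun i => by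
    have := mul_pos Real.pi_pos (neg_pos.2 (hd i))
    simp only [mul_re, mul_im, ofReal_re, ofReal_im, I_re, I_im]
    linarith), Finset.prod_mul_distrib, ← Complex.exp_sum, phase, Finset.mul_sum, Finset.mul_sum]
  congr 1
  · refine Finset.prod_congr rfl fun i _ => ?_
    congr 1
    have := hd0 i
    field_simp
  · congr 1
    refine Finset.sum_congr rfl fun i _ => ?_
    have := hd0 i
    field_simp
    ring

theorem det_ne_zero_of_quad_im_neg {κ : Matrix ι ι ℂ} (hs : κᵀ = κ)
    (him : ∀ v : ι → ℝ, v ≠ 0 → (quad κ v).im < 0) : κ.det ≠ 0 := by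
  obtain ⟨P, d, -, hd, h⟩ := exists_congruent_diagonal hs him
  intro h0
  have h1 := congrArg det h
  rw [det_mul, det_mul, h0, det_diagonal] at h1
  have h2 : ∏ i, d i ≠ 0 := Finset.prod_ne_zero_iff.2 fun i _ h0 => by simpa [h0] using hd i
  exact h2 (by rw [← h1]; ring)

/-- Completing the square in the Gaussian integral. -/
theorem gaussInt_eq {κ : Matrix ι ι ℂ} (hs : κᵀ = κ)
    (him : ∀ v : ι → ℝ, v ≠ 0 → (quad κ v).im < 0) (b : ι → ℝ) :
    gaussInt κ b = gaussInt κ 0 * phase (1 / 2 * quad κ⁻¹ b) := by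
  obtain ⟨P, d, hP, hd, h⟩ := exists_congruent_diagonal hs him
  have hd0 : ∀ i, d i ≠ 0 := fun i h0 => by simpa [h0] using hd i
  have hPc : IsUnit (P.map ofReal : Matrix ι ι ℂ).det := by
    rw [det_map_ofReal]
    simpa using hP
  have hκ : κ⁻¹ = ((Pᵀ).map ofReal)ᵀ * diagonal (fun i => (d i)⁻¹) * (Pᵀ).map ofReal := by
    have hdd : (diagonal d)⁻¹ = diagonal fun i => (d i)⁻¹ :=
      Matrix.inv_eq_right_inv (by
        rw [diagonal_mul_diagonal, ← diagonal_one]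
        congr 1
        funext i
        exact mul_inv_cancel₀ (hd0 i))
    have hPt : IsUnit ((P.map ofReal : Matrix ι ι ℂ)ᵀ).det := by rwa [det_transpose]
    rw [← hdd, ← h, Matrix.mul_inv_rev, Matrix.mul_inv_rev, transpose_map, transpose_transpose,
      ← Matrix.mul_assoc, Matrix.mul_nonsing_inv _ hPc, Matrix.one_mul, Matrix.mul_assoc,
      Matrix.nonsing_inv_mul _ hPt, Matrix.mul_one]
  rw [hκ, ← quad_mulVec, quad_diagonal, gaussInt_of_congruent hP hd h,
    gaussInt_of_congruent hP hd h]
  simp only [mulVec_zero, Pi.zero_apply, ofReal_zero]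
  simp [phase_zero, div_eq_inv_mul, mul_assoc]

/-- The total Gaussian integral is a square root of `1 / det (i κ)`. Which one it is cannot be read
off from the determinant; `gaussInt_mobius` keeps track of it. -/
theorem gaussInt_zero_sq {κ : Matrix ι ι ℂ} (hs : κᵀ = κ)
    (him : ∀ v : ι → ℝ, v ≠ 0 → (quad κ v).im < 0) :
    gaussInt κ 0 ^ 2 * (I • κ).det = 1 := by
  obtain ⟨P, d, hP, hd, h⟩ := exists_congruent_diagonal hs him
  have h1 := congrArg det h
  rw [det_mul, det_mul, det_transpose, det_map_ofReal, det_diagonal] at h1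
  have h2 : (∏ i, (1 / (I * d i)) ^ (1 / 2 : ℂ)) ^ 2 = ∏ i, (1 / (I * d i)) := by
    rw [← Finset.prod_pow]
    exact Finset.prod_congr rfl fun i _ => cpow_half_sq _
  have h3 : ((|P.det| : ℝ) : ℂ) ^ 2 = (P.det : ℂ) ^ 2 := by exact_mod_cast sq_abs P.det
  rw [gaussInt_of_congruent hP hd h]
  simp only [mulVec_zero, Pi.zero_apply, ofReal_zero]
  simp only [ne_eq, OfNat.ofNat_ne_zero, not_false_eq_true, zero_pow, zero_div,
    Finset.sum_const_zero, mul_zero, phase_zero, mul_one]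
  rw [mul_pow, h2, h3, det_smul]
  have h4 : ∏ i, (1 / (I * d i)) = (I ^ Fintype.card ι * ∏ i, d i)⁻¹ := by
    simp only [one_div, Finset.prod_inv_distrib, Finset.prod_mul_distrib, Finset.prod_const,
      Finset.card_univ]
  rw [h4, ← h1]
  have h5 := det_ne_zero_of_quad_im_neg hs him
  have h6 : (P.det : ℂ) ≠ 0 := by exact_mod_cast hP
  have h7 : I ^ Fintype.card ι ≠ 0 := pow_ne_zero _ I_ne_zero
  field_simp

theorem integrable_exp_neg_dotProduct {c : ℝ} (hc : 0 < c) :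
    Integrable fun v : ι → ℝ => Real.exp (-c * (v ⬝ᵥ v)) := by
  have h1 : ∀ v : ι → ℝ, Real.exp (-c * (v ⬝ᵥ v)) = ∏ i, Real.exp (-c * v i ^ 2) := fun v => by
    rw [← Real.exp_sum, dotProduct, Finset.mul_sum]
    simp only [pow_two]
  simp only [h1]
  exact Integrable.fintype_prod (f := fun (_ : ι) (x : ℝ) => Real.exp (-c * x ^ 2))
    fun i => integrable_exp_neg_mul_sq hc

theorem norm_phase_quad (κ : Matrix ι ι ℂ) (t : ℝ) (v : ι → ℝ) :
    ‖phase (t - 1 / 2 * quad κ v)‖ = Real.exp (Real.pi * (quad κ v).im) := by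
  rw [norm_phase]
  congr 1
  simp
  ring

theorem norm_phase_quad_le {κ : Matrix ι ι ℂ} {c : ℝ}
    (hκ : ∀ v : ι → ℝ, (quad κ v).im ≤ -c * (v ⬝ᵥ v)) (t : ℝ) (v : ι → ℝ) :
    ‖phase (t - 1 / 2 * quad κ v)‖ ≤ Real.exp (-(Real.pi * c) * (v ⬝ᵥ v)) := by
  rw [norm_phase_quad, Real.exp_le_exp]
  have := mul_le_mul_of_nonneg_left (hκ v) Real.pi_pos.le
  linarith

theorem dotProduct_self_pos {v : ι → ℝ} (hv : v ≠ 0) : 0 < v ⬝ᵥ v := by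
  refine lt_of_le_of_ne (Finset.sum_nonneg fun i _ => mul_self_nonneg _) fun h => hv ?_
  exact dotProduct_self_eq_zero.1 h.symm

theorem quad_im_neg {κ : Matrix ι ι ℂ} {c : ℝ} (hc : 0 < c)
    (hκ : ∀ v : ι → ℝ, (quad κ v).im ≤ -c * (v ⬝ᵥ v)) (v : ι → ℝ) (hv : v ≠ 0) :
    (quad κ v).im < 0 :=
  (hκ v).trans_lt (by have := mul_pos hc (dotProduct_self_pos hv); linarith)

/-! ### Complex symmetric matrices under unipotent symplectic matrices -/

/-- The action `κ ↦ κ (1 - y κ)⁻¹` of a real symmetric matrix `y`, regarded as a unipotent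
symplectic matrix, on complex symmetric matrices. It is meaningful only if `1 - y κ` is
invertible. -/
def mobius (y : Matrix ι ι ℝ) (κ : Matrix ι ι ℂ) : Matrix ι ι ℂ :=
  κ * (1 - y.map ofReal * κ)⁻¹

/-- The complex symmetric matrix `k - i ε`, with negative definite imaginary part, which
regularizes the real symmetric matrix `k`. -/
def damp (k : Matrix ι ι ℝ) (ε : ℝ) : Matrix ι ι ℂ := k.map ofReal - (ε * I : ℂ) • 1

theorem damp_transpose {k : Matrix ι ι ℝ} (hk : kᵀ = k) (ε : ℝ) : (damp k ε)ᵀ = damp k ε := by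
  rw [damp, transpose_sub, ← transpose_map, hk]
  simp

theorem isHermitian_map_ofReal {k : Matrix ι ι ℝ} (hk : kᵀ = k) :
    (k.map ofReal : Matrix ι ι ℂ).IsHermitian := by
  ext i j
  simp [show k j i = k i j from congrFun (congrFun hk i) j]

theorem im_star_dotProduct_damp {k : Matrix ι ι ℝ} (hk : kᵀ = k) (ε : ℝ) (w : ι → ℂ) :
    (star w ⬝ᵥ damp k ε *ᵥ w).im = -ε * ∑ i, normSq (w i) := by
  have h1 : (star w ⬝ᵥ k.map ofReal *ᵥ w).im = 0 :=
    (isHermitian_map_ofReal hk).im_star_dotProduct_mulVec_self w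
  have h2 : star w ⬝ᵥ w = ((∑ i, normSq (w i) : ℝ) : ℂ) := by
    simp [dotProduct, normSq_eq_conj_mul_self]
  rw [damp, sub_mulVec, dotProduct_sub, smul_mulVec, one_mulVec, dotProduct_smul, h2, sub_im, h1]
  simp

/-- The Hermitian identity behind the invariance of the Siegel half space under `mobius`: for
`v = (1 - y κ) w` it computes the imaginary part of `v* κ (1 - y κ)⁻¹ v`. -/
theorem im_star_dotProduct_mobius {k y : Matrix ι ι ℝ} (hk : kᵀ = k) (hy : yᵀ = y) (ε : ℝ)
    (w : ι → ℂ) :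
    (star ((1 - y.map ofReal * damp k ε) *ᵥ w) ⬝ᵥ damp k ε *ᵥ w).im =
      -ε * ∑ i, normSq (w i) := by
  have h1 : (star (damp k ε *ᵥ w) ⬝ᵥ y.map ofReal *ᵥ (damp k ε *ᵥ w)).im = 0 :=
    (isHermitian_map_ofReal hy).im_star_dotProduct_mulVec_self _
  have h2 : star (y.map ofReal *ᵥ (damp k ε *ᵥ w)) ⬝ᵥ damp k ε *ᵥ w =
      star (damp k ε *ᵥ w) ⬝ᵥ y.map ofReal *ᵥ (damp k ε *ᵥ w) := by
    rw [star_mulVec, (isHermitian_map_ofReal hy).eq, ← dotProduct_mulVec]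
  rw [sub_mulVec, one_mulVec, star_sub, sub_dotProduct, sub_im, im_star_dotProduct_damp hk,
    ← mulVec_mulVec, h2, h1, sub_zero]

theorem sum_normSq_eq_zero {w : ι → ℂ} (h : ∑ i, normSq (w i) = 0) : w = 0 := by
  funext i
  exact normSq_eq_zero.1
    ((Finset.sum_eq_zero_iff_of_nonneg fun i _ => normSq_nonneg _).1 h i (Finset.mem_univ i))

theorem isUnit_one_sub_mul_damp {k y : Matrix ι ι ℝ} (hk : kᵀ = k) (hy : yᵀ = y) {ε : ℝ}
    (hε : 0 < ε) : IsUnit (1 - y.map ofReal * damp k ε).det := by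
  rw [isUnit_iff_ne_zero]
  intro h0
  obtain ⟨w, hw, hw'⟩ := Matrix.exists_mulVec_eq_zero_iff.2 h0
  have h1 := im_star_dotProduct_mobius hk hy ε w
  rw [hw'] at h1
  refine hw (sum_normSq_eq_zero ?_)
  simpa [hε.ne'] using h1

theorem mobius_transpose {k y : Matrix ι ι ℝ} (hk : kᵀ = k) (hy : yᵀ = y) {ε : ℝ}
    (hε : 0 < ε) : (mobius y (damp k ε))ᵀ = mobius y (damp k ε) := by
  have hu := isUnit_one_sub_mul_damp hk hy hε
  have hu' : IsUnit (1 - y.map ofReal * damp k ε)ᵀ.det := by rwa [det_transpose]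
  have h1 : (1 - y.map ofReal * damp k ε)ᵀ * damp k ε =
      damp k ε * (1 - y.map ofReal * damp k ε) := by
    rw [transpose_sub, transpose_mul, damp_transpose hk, ← transpose_map, hy, transpose_one,
      Matrix.sub_mul, Matrix.mul_sub, Matrix.one_mul, Matrix.mul_one, Matrix.mul_assoc]
  rw [mobius, transpose_mul, damp_transpose hk, transpose_nonsing_inv]
  calc _ = ((1 - y.map ofReal * damp k ε)ᵀ)⁻¹ * (damp k ε * (1 - y.map ofReal * damp k ε)) *
        (1 - y.map ofReal * damp k ε)⁻¹ := by
        rw [Matrix.mul_assoc, Matrix.mul_assoc, Matrix.mul_nonsing_inv _ hu, Matrix.mul_one]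
    _ = _ := by rw [← h1, ← Matrix.mul_assoc, Matrix.nonsing_inv_mul _ hu', Matrix.one_mul]

theorem sum_normSq_mulVec_le (M : Matrix ι ι ℂ) (w : ι → ℂ) :
    ∑ i, normSq ((M *ᵥ w) i) ≤ (∑ i, ∑ j, normSq (M i j)) * ∑ j, normSq (w j) := by
  rw [Finset.sum_mul]
  refine Finset.sum_le_sum fun i _ => ?_
  have h1 : ‖(M *ᵥ w) i‖ ≤ ∑ j, ‖M i j‖ * ‖w j‖ := by
    simp only [mulVec, dotProduct, ← norm_mul]
    exact norm_sum_le _ _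
  simp only [normSq_eq_norm_sq]
  exact (pow_le_pow_left₀ (norm_nonneg _) h1 2).trans (Finset.sum_mul_sq_le_sq_mul_sq _ _ _)

/-- The imaginary part of `mobius y (damp k ε)` is negative definite, with a bound that is uniform
as long as the entries of `1 - y κ` are bounded. -/
theorem quad_mobius_im_le {k y : Matrix ι ι ℝ} (hk : kᵀ = k) (hy : yᵀ = y) {ε C : ℝ}
    (hε : 0 < ε) (hC : 0 < C)
    (hC' : ∑ i, ∑ j, normSq ((1 - y.map ofReal * damp k ε) i j) ≤ C) (v : ι → ℝ) :
    (quad (mobius y (damp k ε)) v).im ≤ -(ε / C) * (v ⬝ᵥ v) := by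
  have hu := isUnit_one_sub_mul_damp hk hy hε
  set N := 1 - y.map ofReal * damp k ε with hN
  have h1 : N *ᵥ (N⁻¹ *ᵥ cvec v) = cvec v := by
    rw [mulVec_mulVec, Matrix.mul_nonsing_inv _ hu, one_mulVec]
  have h2 : quad (mobius y (damp k ε)) v =
      star (N *ᵥ (N⁻¹ *ᵥ cvec v)) ⬝ᵥ damp k ε *ᵥ (N⁻¹ *ᵥ cvec v) := by
    rw [h1, quad, mobius, ← mulVec_mulVec]
    congr 1
    ext i
    simp [cvec]
  have h3 : v ⬝ᵥ v = ∑ i, normSq ((N *ᵥ (N⁻¹ *ᵥ cvec v)) i) := by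
    rw [h1]
    simp [dotProduct, cvec]
  have h4 : v ⬝ᵥ v ≤ C * ∑ i, normSq ((N⁻¹ *ᵥ cvec v) i) :=
    h3.le.trans ((sum_normSq_mulVec_le _ _).trans
      (mul_le_mul_of_nonneg_right hC' (Finset.sum_nonneg fun i _ => normSq_nonneg _)))
  rw [h2, im_star_dotProduct_mobius hk hy]
  have h5 : ε / C * (v ⬝ᵥ v) ≤ ε * ∑ i, normSq ((N⁻¹ *ᵥ cvec v) i) := by
    rw [div_mul_eq_mul_div, div_le_iff₀ hC, mul_assoc]
    exact mul_le_mul_of_nonneg_left (by linarith) hε.le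
  linarith

theorem mobius_zero (κ : Matrix ι ι ℂ) : mobius 0 κ = κ := by
  simp [mobius, show (0 : Matrix ι ι ℝ).map ofReal = (0 : Matrix ι ι ℂ) by ext; simp]

theorem quad_damp_im_le {k : Matrix ι ι ℝ} (hk : kᵀ = k) {ε : ℝ} (v : ι → ℝ) :
    (quad (damp k ε) v).im ≤ -ε * (v ⬝ᵥ v) := by
  have h1 := im_star_dotProduct_damp hk ε (cvec v)
  have h2 : star (cvec v) = cvec v := by ext i; simp [cvec]
  rw [h2] at h1
  rw [quad, h1]
  simp [cvec, dotProduct]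

/-! ### The sign of the square root of the determinant -/

theorem continuousAt_matrix_inv {A : Matrix ι ι ℂ} (hA : A.det ≠ 0) :
    ContinuousAt (fun B : Matrix ι ι ℂ => B⁻¹) A := by
  have h1 : (fun B : Matrix ι ι ℂ => B⁻¹) = fun B => (B.det)⁻¹ • B.adjugate := by
    funext B
    rw [Matrix.inv_def, Ring.inverse_eq_inv']
  rw [h1]
  exact ((continuous_id.matrix_det.continuousAt).inv₀ hA).smul
    continuous_id.matrix_adjugate.continuousAt

theorem continuous_map_ofReal : Continuous fun y : Matrix ι ι ℝ => (y.map ofReal : Matrix ι ι ℂ) :=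
  continuous_id.matrix_map continuous_ofReal

theorem continuous_one_sub_mul : Continuous fun q : Matrix ι ι ℝ × Matrix ι ι ℂ =>
    1 - q.1.map ofReal * q.2 :=
  continuous_const.sub ((continuous_map_ofReal.comp continuous_fst).matrix_mul continuous_snd)

theorem continuousAt_quad_mobius {y : Matrix ι ι ℝ} {κ : Matrix ι ι ℂ}
    (h : (1 - y.map ofReal * κ).det ≠ 0) (v : ι → ℝ) :
    ContinuousAt (fun q : Matrix ι ι ℝ × Matrix ι ι ℂ => quad (mobius q.1 q.2) v) (y, κ) := by
  have h1 : ContinuousAt (fun q : Matrix ι ι ℝ × Matrix ι ι ℂ => mobius q.1 q.2) (y, κ) := by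
    have h2 : ContinuousAt (fun q : Matrix ι ι ℝ × Matrix ι ι ℂ =>
        (1 - q.1.map ofReal * q.2)⁻¹) (y, κ) :=
      ContinuousAt.comp (g := fun B : Matrix ι ι ℂ => B⁻¹) (continuousAt_matrix_inv h)
        continuous_one_sub_mul.continuousAt
    exact ((continuous_fst.matrix_mul continuous_snd).continuousAt (x := (κ, _))).comp
      (f := fun q : Matrix ι ι ℝ × Matrix ι ι ℂ => (q.2, (1 - q.1.map ofReal * q.2)⁻¹))
      (continuousAt_snd.prodMk h2)
  have h3 : Continuous fun M : Matrix ι ι ℂ => quad M v :=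
    continuous_const.dotProduct (continuous_id.matrix_mulVec continuous_const)
  exact h3.continuousAt.comp h1

theorem continuous_damp (k : Matrix ι ι ℝ) : Continuous (damp k) := by
  unfold damp
  fun_prop

theorem damp_zero (k : Matrix ι ι ℝ) : damp k 0 = k.map ofReal := by simp [damp]

/-- The square root of the determinant by which the Gaussian integral transforms under `mobius`
is the principal one as long as the determinant avoids the negative axis along a segment. -/
theorem gaussInt_mobius {k y : Matrix ι ι ℝ} (hk : kᵀ = k) (hy : yᵀ = y) {ε : ℝ} (hε : 0 < ε)
    (hdet : ∀ r ∈ Set.Icc (0 : ℝ) 1,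
      (1 - (r • y).map ofReal * damp k ε).det ∈ slitPlane) :
    gaussInt (mobius y (damp k ε)) 0 =
      gaussInt (damp k ε) 0 * (1 - y.map ofReal * damp k ε).det ^ (1 / 2 : ℂ) := by
  have hyr : ∀ r : ℝ, (r • y)ᵀ = r • y := fun r => by rw [transpose_smul, hy]
  set κ := damp k ε with hκ
  -- `C` bounds the entries of `1 - r y κ` for all `r ∈ [0, 1]`, which gives a Gaussian majorant
  -- independent of `r`. The summand `1` makes it positive also in dimension zero.
  let C : ℝ := 1 + ∑ i, ∑ j, (2 * normSq ((1 : Matrix ι ι ℂ) i j) +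
    2 * normSq ((y.map ofReal * κ) i j))
  have hC : 0 < C := by
    have : 0 ≤ ∑ i, ∑ j, (2 * normSq ((1 : Matrix ι ι ℂ) i j) +
      2 * normSq ((y.map ofReal * κ) i j)) :=
      Finset.sum_nonneg fun i _ => Finset.sum_nonneg fun j _ => by
        have := normSq_nonneg ((1 : Matrix ι ι ℂ) i j)
        have := normSq_nonneg ((y.map ofReal * κ) i j)
        linarith
    simp only [C]; linarith
  have hsm : ∀ r : ℝ, (r • y).map ofReal * κ = (r : ℂ) • (y.map ofReal * κ) := fun r => by
    have : (r • y).map ofReal = (r : ℂ) • (y.map ofReal : Matrix ι ι ℂ) := by ext; simp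
    rw [this, Matrix.smul_mul]
  have hC' : ∀ r ∈ Set.Icc (0 : ℝ) 1,
      ∑ i, ∑ j, normSq ((1 - (r • y).map ofReal * κ) i j) ≤ C := by
    intro r hr
    refine le_trans (Finset.sum_le_sum fun i _ => Finset.sum_le_sum fun j _ => ?_)
      (le_add_of_nonneg_left zero_le_one)
    rw [hsm, Matrix.sub_apply, Matrix.smul_apply, smul_eq_mul]
    have h1 : ‖(1 : Matrix ι ι ℂ) i j - r * (y.map ofReal * κ) i j‖ ≤
        ‖(1 : Matrix ι ι ℂ) i j‖ + ‖(y.map ofReal * κ) i j‖ := by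
      refine (norm_sub_le _ _).trans (add_le_add le_rfl ?_)
      rw [norm_mul, norm_real, Real.norm_of_nonneg hr.1]
      exact mul_le_of_le_one_left (norm_nonneg _) hr.2
    simp only [normSq_eq_norm_sq]
    have h2 := pow_le_pow_left₀ (norm_nonneg _) h1 2
    have h3 := sq_nonneg (‖(1 : Matrix ι ι ℂ) i j‖ - ‖(y.map ofReal * κ) i j‖)
    linarith
  have hle : ∀ r ∈ Set.Icc (0 : ℝ) 1, ∀ v : ι → ℝ,
      (quad (mobius (r • y) κ) v).im ≤ -(ε / C) * (v ⬝ᵥ v) := fun r hr =>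
    quad_mobius_im_le hk (hyr r) hε hC (hC' r hr)
  have hεC : 0 < ε / C := div_pos hε hC
  have hf : ContinuousOn (fun r : ℝ => gaussInt (mobius (r • y) κ) 0) (Set.Icc 0 1) := by
    refine continuousOn_of_dominated
      (bound := fun v => Real.exp (-(Real.pi * (ε / C)) * (v ⬝ᵥ v))) (fun r _ => ?_)
      (fun r hr => Filter.Eventually.of_forall fun v => norm_phase_quad_le (hle r hr) _ v)
      (integrable_exp_neg_dotProduct (mul_pos Real.pi_pos hεC))
      (Filter.Eventually.of_forall fun v r hr => ContinuousAt.continuousWithinAt ?_)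
    · exact (continuous_phase.comp (by
        have := continuous_quad (mobius (r • y) κ)
        simp only [zero_dotProduct]
        fun_prop)).aestronglyMeasurable
    · have h1 : ContinuousAt (fun r : ℝ => quad (mobius (r • y) κ) v) r :=
        ContinuousAt.comp (f := fun r : ℝ => (r • y, κ))
          (continuousAt_quad_mobius (slitPlane_ne_zero (hdet r hr)) v)
          (by fun_prop)
      exact continuous_phase.continuousAt.comp (continuousAt_const.sub (continuousAt_const.mul h1))
  have hg : ContinuousOn (fun r : ℝ => gaussInt κ 0 *
      (1 - (r • y).map ofReal * κ).det ^ (1 / 2 : ℂ)) (Set.Icc 0 1) := by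
    refine continuousOn_const.mul (ContinuousOn.cpow_const ?_ hdet)
    exact ((continuous_one_sub_mul.comp (by fun_prop :
      Continuous fun r : ℝ => (r • y, κ))).matrix_det).continuousOn
  have hκneg := quad_im_neg hε (quad_damp_im_le hk (ε := ε))
  have hG := gaussInt_zero_sq (damp_transpose hk ε) hκneg
  have hG0 : gaussInt κ 0 ≠ 0 := fun h0 => by rw [h0] at hG; simp at hG
  have hI : I ^ Fintype.card ι ≠ 0 := pow_ne_zero _ I_ne_zero
  have hκ0 := det_ne_zero_of_quad_im_neg (damp_transpose hk ε) hκneg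
  -- Both sides are continuous in `r`, have equal squares, and agree at `r = 0`.
  have key := isPreconnected_Icc.eq_of_sq_eq hf hg (fun r hr => by
      have h1 := gaussInt_zero_sq (mobius_transpose hk (hyr r) hε)
        (quad_im_neg hεC (hle r hr))
      have h2 := slitPlane_ne_zero (hdet r hr)
      simp only [Pi.pow_apply, mul_pow, cpow_half_sq]
      rw [det_smul, mobius, det_mul, det_nonsing_inv, Ring.inverse_eq_inv'] at h1
      rw [det_smul] at hG
      change gaussInt κ 0 ^ 2 * (I ^ Fintype.card ι * κ.det) = 1 at hG
      change gaussInt (mobius (r • y) κ) 0 ^ 2 * (I ^ Fintype.card ι * (κ.det *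
        (1 - (r • y).map ofReal * κ).det⁻¹)) = 1 at h1
      have h3 : gaussInt (mobius (r • y) κ) 0 ^ 2 * (I ^ Fintype.card ι * κ.det) =
          (1 - (r • y).map ofReal * κ).det := by
        rw [← mul_assoc _ κ.det, ← mul_assoc, mul_inv_eq_one₀ h2] at h1
        exact h1
      refine mul_right_cancel₀ (mul_ne_zero hI hκ0) (h3.trans ?_)
      linear_combination -(1 - (r • y).map ofReal * κ).det * hG) (fun {r} hr h0 => by
      have h1 := cpow_half_sq (1 - (r • y).map ofReal * κ).det
      rcases mul_eq_zero.1 h0 with h | h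
      · exact hG0 h
      · rw [h] at h1
        exact slitPlane_ne_zero (hdet r hr) (by rw [← h1]; simp)) (y := 0) (by simp)
      (by simp [mobius_zero])
  simpa using key (Set.right_mem_Icc.2 zero_le_one)

theorem one_sub_map_ofReal (k y : Matrix ι ι ℝ) :
    (1 - y.map ofReal * k.map ofReal : Matrix ι ι ℂ) = (1 - y * k).map ofReal := by
  ext i j
  by_cases hij : i = j
  · subst hij; simp [Matrix.mul_apply]
  · simp [Matrix.mul_apply, hij]

theorem det_one_sub_map_ofReal (k y : Matrix ι ι ℝ) :
    (1 - y.map ofReal * k.map ofReal : Matrix ι ι ℂ).det = ((1 - y * k).det : ℝ) := by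
  rw [one_sub_map_ofReal, det_map_ofReal]

/-- By compactness of `[0, 1]`, positivity of the real determinants survives a small damping. -/
theorem eventually_det_mem_slitPlane {k y : Matrix ι ι ℝ}
    (hdet : ∀ r ∈ Set.Icc (0 : ℝ) 1, 0 < (1 - (r • y) * k).det) :
    ∀ᶠ ε : ℝ in 𝓝 0, ∀ r ∈ Set.Icc (0 : ℝ) 1,
      (1 - (r • y).map ofReal * damp k ε).det ∈ slitPlane := by
  refine isCompact_Icc.eventually_forall_of_forall_eventually fun r hr => ?_
  have hc : Continuous fun q : ℝ × ℝ => (1 - (q.2 • y).map ofReal * damp k q.1).det :=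
    (continuous_one_sub_mul.comp (((by fun_prop : Continuous fun q : ℝ × ℝ => q.2 • y)).prodMk
      ((continuous_damp k).comp continuous_fst))).matrix_det
  refine hc.continuousAt.eventually (isOpen_slitPlane.mem_nhds ?_)
  simp only [damp_zero, det_one_sub_map_ofReal]
  exact ofReal_mem_slitPlane.2 (hdet r hr)

/-! ### Oscillatory integrals as limits of damped ones -/

/-- The operator `F⁻¹ ∘ e(-v · κ v / 2) ∘ F` with a shift: the transform of `f`, multiplied by a
quadratic phase centred at `a`, is transformed back and evaluated at `x`. The order of integration
matters: for real `κ` the double integral does not converge absolutely. -/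
def oscInt (κ : Matrix ι ι ℂ) (a x : ι → ℝ) (f : (ι → ℝ) → ℂ) : ℂ :=
  ∫ v : ι → ℝ, phase ((-(x ⬝ᵥ v) : ℝ) - 1 / 2 * quad κ (v - a)) *
    ∫ p : ι → ℝ, phase (v ⬝ᵥ p : ℝ) * f p

/-- With a damped quadratic phase the two integrations can be interchanged. -/
theorem oscInt_eq_of_damped {κ : Matrix ι ι ℂ} {c : ℝ} (hc : 0 < c)
    (hκ : ∀ v : ι → ℝ, (quad κ v).im ≤ -c * (v ⬝ᵥ v)) (a x : ι → ℝ) {f : (ι → ℝ) → ℂ}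
    (hf : Integrable f) :
    oscInt κ a x f = ∫ p, f p * (phase ((p - x) ⬝ᵥ a : ℝ) * gaussInt κ (p - x)) := by
  have hcont := continuous_quad κ
  have h1 : Integrable fun v : ι → ℝ => phase ((-(x ⬝ᵥ v) : ℝ) - 1 / 2 * quad κ (v - a)) := by
    refine (((integrable_exp_neg_dotProduct (mul_pos Real.pi_pos hc)).comp_sub_right a)).mono'
      ?_ (Filter.Eventually.of_forall fun v => ?_)
    · refine (continuous_phase.comp ?_).aestronglyMeasurable
      simp only [dotProduct]
      fun_prop
    · rw [norm_phase_quad]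
      have := norm_phase_quad_le hκ 0 (v - a)
      rwa [norm_phase_quad] at this
  have h2 : Integrable (fun q : (ι → ℝ) × (ι → ℝ) =>
      phase ((-(x ⬝ᵥ q.1) : ℝ) - 1 / 2 * quad κ (q.1 - a)) * (phase (q.1 ⬝ᵥ q.2 : ℝ) * f q.2))
      (volume.prod volume) := by
    have h3 := h1.mul_prod hf
    refine (h3.bdd_mul (c := 1) (f := fun q => phase (q.1 ⬝ᵥ q.2 : ℝ)) ?_
      (Filter.Eventually.of_forall fun q => (norm_phase_ofReal _).le)).congr
      (Filter.Eventually.of_forall fun q => by ring)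
    refine (continuous_phase.comp ?_).aestronglyMeasurable
    simp only [dotProduct]
    fun_prop
  simp only [oscInt, ← integral_const_mul]
  rw [integral_integral_swap h2]
  refine integral_congr_ae (Filter.Eventually.of_forall fun p => ?_)
  simp only []
  rw [gaussInt, ← integral_const_mul, ← integral_const_mul,
    ← integral_sub_right_eq_self (fun v => f p * _) a]
  refine integral_congr_ae (Filter.Eventually.of_forall fun v => ?_)
  simp only []
  rw [mul_comm (phase _) (f p), mul_left_comm, ← phase_add, ← phase_add]
  congr 2
  simp only [dotProduct_sub, sub_dotProduct, dotProduct_comm v p]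
  push_cast
  ring

theorem quad_map_ofReal (y : Matrix ι ι ℝ) (v : ι → ℝ) :
    quad (y.map ofReal) v = ((v ⬝ᵥ y *ᵥ v : ℝ) : ℂ) := by
  rw [quad, ← cvec_mulVec, cvec_dotProduct_cvec]

theorem quad_sub (κ κ' : Matrix ι ι ℂ) (v : ι → ℝ) :
    quad (κ - κ') v = quad κ v - quad κ' v := by
  simp [quad, sub_mulVec]

theorem dotProduct_mulVec_comm {y : Matrix ι ι ℝ} (hy : yᵀ = y) (v w : ι → ℝ) :
    v ⬝ᵥ y *ᵥ w = w ⬝ᵥ y *ᵥ v := by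
  conv_lhs => rw [← hy]
  rw [mulVec_transpose, dotProduct_comm, ← dotProduct_mulVec]

theorem exists_bound_entries (M : Matrix ι ι ℂ) :
    ∃ C : ℝ, 0 < C ∧ ∑ i, ∑ j, normSq (M i j) ≤ C :=
  ⟨max 1 (∑ i, ∑ j, normSq (M i j)), lt_max_of_lt_left one_pos, le_max_right _ _⟩

theorem quad_mobius_im_nonpos {k y : Matrix ι ι ℝ} (hk : kᵀ = k) (hy : yᵀ = y) {ε : ℝ}
    (hε : 0 < ε) (v : ι → ℝ) : (quad (mobius y (damp k ε)) v).im ≤ 0 := by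
  obtain ⟨C, hC, hC'⟩ := exists_bound_entries (1 - y.map ofReal * damp k ε)
  refine (quad_mobius_im_le hk hy hε hC hC' v).trans ?_
  have h1 : 0 ≤ v ⬝ᵥ v := Finset.sum_nonneg fun i _ => mul_self_nonneg _
  have h2 := mul_nonneg (div_pos hε hC).le h1
  linarith

/-- The intertwining relation for damped quadratic phases: after interchanging the integrations
the two Gaussian kernels agree pointwise, because `(mobius y κ)⁻¹ = κ⁻¹ - y`. -/
theorem oscInt_mobius_damp {k y : Matrix ι ι ℝ} (hk : kᵀ = k) (hy : yᵀ = y) {ε : ℝ} (hε : 0 < ε)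
    (hdet : ∀ r ∈ Set.Icc (0 : ℝ) 1,
      (1 - (r • y).map ofReal * damp k ε).det ∈ slitPlane) (x : ι → ℝ) {f : (ι → ℝ) → ℂ}
    (hf : Integrable f) :
    oscInt (mobius y (damp k ε)) 0 x (fun p => phase (1 / 2 * (p ⬝ᵥ y *ᵥ p) : ℝ) * f p) =
      (1 - y.map ofReal * damp k ε).det ^ (1 / 2 : ℂ) * (phase (1 / 2 * (x ⬝ᵥ y *ᵥ x) : ℝ) *
        oscInt (damp k ε) (y *ᵥ x) x f) := by
  obtain ⟨C, hC, hC'⟩ := exists_bound_entries (1 - y.map ofReal * damp k ε)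
  have hle := quad_mobius_im_le hk hy hε hC hC'
  have hεC : 0 < ε / C := div_pos hε hC
  have hf' : Integrable fun p => phase (1 / 2 * (p ⬝ᵥ y *ᵥ p) : ℝ) * f p := by
    refine hf.bdd_mul (c := 1) ?_ (Filter.Eventually.of_forall fun q => (norm_phase_ofReal _).le)
    refine (continuous_phase.comp ?_).aestronglyMeasurable
    simp only [dotProduct, mulVec]
    fun_prop
  have hκneg := quad_im_neg hε (quad_damp_im_le hk (ε := ε))
  have hκ0 := (det_ne_zero_of_quad_im_neg (damp_transpose hk ε) hκneg).isUnit
  have hu := isUnit_one_sub_mul_damp hk hy hε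
  rw [oscInt_eq_of_damped hεC hle _ _ hf', oscInt_eq_of_damped hε (quad_damp_im_le hk) _ _ hf,
    ← mul_assoc, ← integral_const_mul]
  refine integral_congr_ae (Filter.Eventually.of_forall fun p => ?_)
  simp only []
  rw [gaussInt_eq (mobius_transpose hk hy hε) (quad_im_neg hεC hle),
    gaussInt_eq (damp_transpose hk ε) hκneg, gaussInt_mobius hk hy hε hdet]
  have hinv : (mobius y (damp k ε))⁻¹ = (damp k ε)⁻¹ - y.map ofReal := by
    rw [mobius, Matrix.mul_inv_rev, Matrix.nonsing_inv_nonsing_inv _ hu, Matrix.sub_mul,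
      Matrix.one_mul, Matrix.mul_assoc, Matrix.mul_nonsing_inv _ hκ0, Matrix.mul_one]
  rw [hinv, quad_sub, quad_map_ofReal, dotProduct_zero, ofReal_zero, phase_zero]
  have h1 : phase (1 / 2 * (p ⬝ᵥ y *ᵥ p) : ℝ) *
        phase (1 / 2 * (quad (damp k ε)⁻¹ (p - x) - ((p - x) ⬝ᵥ y *ᵥ (p - x) : ℝ))) =
      phase (1 / 2 * (x ⬝ᵥ y *ᵥ x) : ℝ) * phase ((p - x) ⬝ᵥ y *ᵥ x : ℝ) *
        phase (1 / 2 * quad (damp k ε)⁻¹ (p - x)) := by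
    simp only [← phase_add]
    congr 1
    simp only [mulVec_sub, dotProduct_sub, sub_dotProduct, dotProduct_mulVec_comm hy x p]
    push_cast
    ring
  linear_combination (f p * gaussInt (damp k ε) 0 *
    (1 - y.map ofReal * damp k ε).det ^ (1 / 2 : ℂ)) * h1

theorem tendsto_oscInt {α : Type*} {l : Filter α} [l.IsCountablyGenerated]
    {κ : α → Matrix ι ι ℂ} {κ₀ : Matrix ι ι ℂ} (a x : ι → ℝ) {f : (ι → ℝ) → ℂ}
    (hf : Integrable fun v : ι → ℝ => ∫ p : ι → ℝ, phase (v ⬝ᵥ p : ℝ) * f p)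
    (hle : ∀ᶠ t in l, ∀ v, (quad (κ t) v).im ≤ 0)
    (hlim : ∀ v, Filter.Tendsto (fun t => quad (κ t) v) l (𝓝 (quad κ₀ v))) :
    Filter.Tendsto (fun t => oscInt (κ t) a x f) l (𝓝 (oscInt κ₀ a x f)) := by
  refine tendsto_integral_filter_of_dominated_convergence _
    (Filter.Eventually.of_forall fun t => ?_)
    (hle.mono fun t ht => Filter.Eventually.of_forall fun v => ?_) hf.norm
    (Filter.Eventually.of_forall fun v => ?_)
  · refine (continuous_phase.comp ?_).aestronglyMeasurable.mul hf.1
    have := continuous_quad (κ t)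
    simp only [dotProduct]
    fun_prop
  · rw [norm_mul, norm_phase_quad]
    refine mul_le_of_le_one_left (norm_nonneg _) (Real.exp_le_one_iff.2 ?_)
    exact mul_nonpos_of_nonneg_of_nonpos Real.pi_pos.le (ht _)
  · refine Filter.Tendsto.mul_const _ ((continuous_phase.tendsto _).comp ?_)
    exact tendsto_const_nhds.sub ((hlim _).const_mul _)

theorem tendsto_quad_mobius_damp {k y : Matrix ι ι ℝ}
    (h : (1 - y.map ofReal * k.map ofReal : Matrix ι ι ℂ).det ≠ 0) (v : ι → ℝ) :
    Filter.Tendsto (fun ε : ℝ => quad (mobius y (damp k ε)) v) (𝓝[>] 0)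
      (𝓝 (quad (mobius y (k.map ofReal)) v)) := by
  have h1 : ContinuousAt (fun q : Matrix ι ι ℝ × Matrix ι ι ℂ => quad (mobius q.1 q.2) v)
      (y, damp k 0) := continuousAt_quad_mobius (by rwa [damp_zero]) v
  have h2 : ContinuousAt (fun ε : ℝ => (y, damp k ε)) 0 :=
    (continuous_const.prodMk (continuous_damp k)).continuousAt
  have h3 := (ContinuousAt.comp (f := fun ε : ℝ => (y, damp k ε)) h1 h2).tendsto
  simp only [Function.comp_def, damp_zero] at h3
  exact h3.mono_left nhdsWithin_le_nhds

/-- The factorization of a quadratic phase in position space past a quadratic phase in momentum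
space, in coordinates: positivity of the determinant along a segment fixes the sign of its square
root. -/
theorem oscInt_mobius {k y : Matrix ι ι ℝ} (hk : kᵀ = k) (hy : yᵀ = y)
    (hdet : ∀ r ∈ Set.Icc (0 : ℝ) 1, 0 < (1 - (r • y) * k).det)
    (x : ι → ℝ) {f : (ι → ℝ) → ℂ} (hf : Integrable f)
    (hf₁ : Integrable fun v : ι → ℝ => ∫ p : ι → ℝ, phase (v ⬝ᵥ p : ℝ) * f p)
    (hf₂ : Integrable fun v : ι → ℝ =>
      ∫ p : ι → ℝ, phase (v ⬝ᵥ p : ℝ) * (phase (1 / 2 * (p ⬝ᵥ y *ᵥ p) : ℝ) * f p)) :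
    oscInt (mobius y (k.map ofReal)) 0 x (fun p => phase (1 / 2 * (p ⬝ᵥ y *ᵥ p) : ℝ) * f p) =
      (Real.sqrt (1 - y * k).det : ℝ) * (phase (1 / 2 * (x ⬝ᵥ y *ᵥ x) : ℝ) *
        oscInt (k.map ofReal) (y *ᵥ x) x f) := by
  have hpos : ∀ᶠ ε : ℝ in 𝓝[>] 0, 0 < ε := self_mem_nhdsWithin
  have hslit := (eventually_det_mem_slitPlane hdet).filter_mono
    (nhdsWithin_le_nhds (s := Set.Ioi 0))
  have hd := det_one_sub_map_ofReal k y
  have hd1 : 0 < (1 - y * k).det := by simpa using hdet 1 (by simp)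
  have hd0 : (1 - y.map ofReal * k.map ofReal : Matrix ι ι ℂ).det ≠ 0 := by
    rw [hd]; exact_mod_cast hd1.ne'
  have hdamp : Filter.Tendsto (damp k) (𝓝[>] 0) (𝓝 (k.map ofReal)) := by
    rw [← damp_zero]
    exact (continuous_damp k).continuousAt.tendsto.mono_left nhdsWithin_le_nhds
  have hquad := tendsto_quad_mobius_damp hd0
  have hL : Filter.Tendsto (fun ε => oscInt (mobius y (damp k ε)) 0 x
      fun p => phase (1 / 2 * (p ⬝ᵥ y *ᵥ p) : ℝ) * f p) (𝓝[>] 0)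
      (𝓝 (oscInt (mobius y (k.map ofReal)) 0 x
        fun p => phase (1 / 2 * (p ⬝ᵥ y *ᵥ p) : ℝ) * f p)) := by
    refine tendsto_oscInt 0 x hf₂ ?_ hquad
    filter_upwards [hpos] with ε hε v using quad_mobius_im_nonpos hk hy hε v
  have hR := tendsto_oscInt (l := 𝓝[>] (0 : ℝ)) (κ := damp k) (y *ᵥ x) x hf₁
    (hpos.mono fun ε hε v => (quad_damp_im_le hk v).trans (by
      have : 0 ≤ v ⬝ᵥ v := Finset.sum_nonneg fun i _ => mul_self_nonneg _
      have := mul_nonneg hε.le this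
      linarith))
    (κ₀ := k.map ofReal) (fun v => by
      have h3 : Continuous fun M : Matrix ι ι ℂ => quad M v :=
        continuous_const.dotProduct (continuous_id.matrix_mulVec continuous_const)
      exact (h3.tendsto _).comp hdamp)
  have hD : Filter.Tendsto (fun ε => (1 - y.map ofReal * damp k ε).det ^ (1 / 2 : ℂ)) (𝓝[>] 0)
      (𝓝 (Real.sqrt (1 - y * k).det : ℝ)) := by
    have h1 : ((Real.sqrt (1 - y * k).det : ℝ) : ℂ) = ((1 - y * k).det : ℂ) ^ (1 / 2 : ℂ) := by
      rw [Real.sqrt_eq_rpow, ofReal_cpow hd1.le]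
      simp
    have h2 : Continuous fun ε : ℝ => (1 - y.map ofReal * damp k ε).det :=
      (continuous_one_sub_mul.comp (continuous_const.prodMk (continuous_damp k))).matrix_det
    have h3 := (h2.tendsto 0).mono_left (nhdsWithin_le_nhds (s := Set.Ioi (0 : ℝ)))
    rw [damp_zero, hd] at h3
    rw [h1]
    exact h3.cpow tendsto_const_nhds (ofReal_mem_slitPlane.2 hd1)
  refine tendsto_nhds_unique (hL.congr' ?_) (hD.mul (hR.const_mul _))
  filter_upwards [hpos, hslit] with ε hε hε'
  exact oscInt_mobius_damp hk hy hε hε' x hf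

/-- On vectors of the form `(1 - y k) w` the form `k (1 - y k)⁻¹` is computed without an
inverse. -/
theorem quad_mobius_mulVec {k y : Matrix ι ι ℝ} (h : (1 - y * k).det ≠ 0) (w : ι → ℝ) :
    quad (mobius y (k.map ofReal)) ((1 - y * k) *ᵥ w) =
      (((1 - y * k) *ᵥ w ⬝ᵥ k *ᵥ w : ℝ) : ℂ) := by
  have hu : IsUnit ((1 - y * k).map ofReal : Matrix ι ι ℂ).det := by
    rw [det_map_ofReal]
    simpa using h
  rw [quad, mobius, one_sub_map_ofReal, cvec_mulVec, mulVec_mulVec, Matrix.mul_assoc,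
    Matrix.nonsing_inv_mul _ hu, Matrix.mul_one, ← cvec_mulVec, ← cvec_mulVec, cvec_dotProduct_cvec]

end Gaussian

/-! ### Dual coordinates and densities of Haar measures -/

section Coordinates

variable {T : Type*} [NormedAddCommGroup T] [NormedSpace ℝ T] [FiniteDimensional ℝ T]
  {ω : SymplecticForm T}

/-- The symplectic form embeds `A` into the dual of a complement. -/
theorem finrank_le_of_compl {A X : Lagrangian ω} (hAX : Compl A X) :
    Module.finrank ℝ A ≤ Module.finrank ℝ X := by
  let g : A →ₗ[ℝ] Module.Dual ℝ X := ω.form.compl₁₂ A.toSubmodule.subtype X.toSubmodule.subtype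
  have hg : Function.Injective g := by
    rw [← LinearMap.ker_eq_bot, LinearMap.ker_eq_bot']
    intro a ha
    ext
    refine ω.nondegenerate _ fun z => ?_
    have h1 : ω a (proj hAX.symm z) = 0 := LinearMap.congr_fun ha ⟨_, proj_mem hAX.symm z⟩
    rw [← proj_add_proj hAX z, map_add, h1, A.isotropic a.2 (proj_mem _ _), add_zero]
  exact (LinearMap.finrank_le_finrank_of_injective hg).trans_eq Subspace.dual_finrank_eq

/-- Complementary Lagrangian subspaces have linear coordinates dual to each other with respect to
`h ω`. -/
theorem exists_dual_coordinates {h : ℝ} (hh : h ≠ 0) {A X : Lagrangian ω} (hAX : Compl A X) :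
    ∃ (eA : (Fin (Module.finrank ℝ X) → ℝ) ≃ₗ[ℝ] A) (eX : (Fin (Module.finrank ℝ X) → ℝ) ≃ₗ[ℝ] X),
      ∀ v p, h * ω (eA v) (eX p) = v ⬝ᵥ p := by
  let b := Module.finBasis ℝ X
  let g : A →ₗ[ℝ] (Fin (Module.finrank ℝ X) → ℝ) :=
    LinearMap.pi fun i => h • ω.form.flip (b i) ∘ₗ A.toSubmodule.subtype
  have hga : ∀ a i, g a i = h * ω a (b i) := fun a i => by simp [g]
  have hsum : ∀ (a : A) (p : Fin (Module.finrank ℝ X) → ℝ),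
      h * ω a (b.equivFun.symm p) = g a ⬝ᵥ p := by
    intro a p
    rw [b.equivFun_symm_apply]
    simp only [Submodule.coe_sum, Submodule.coe_smul, map_sum, map_smul, smul_eq_mul, dotProduct,
      hga, Finset.mul_sum]
    exact Finset.sum_congr rfl fun i _ => by ring
  have hg : Function.Injective g := by
    rw [← LinearMap.ker_eq_bot, LinearMap.ker_eq_bot']
    intro a ha
    ext
    refine ω.nondegenerate _ fun z => ?_
    have h1 := hsum a (b.equivFun ⟨_, proj_mem hAX.symm z⟩)
    rw [ha, zero_dotProduct, LinearEquiv.symm_apply_apply] at h1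
    have h2 : ω a (proj hAX.symm z) = 0 := by simpa [hh] using h1
    rw [← proj_add_proj hAX z, map_add, h2, A.isotropic a.2 (proj_mem _ _), add_zero]
  have hdim : Module.finrank ℝ A = Module.finrank ℝ (Fin (Module.finrank ℝ X) → ℝ) := by
    rw [Module.finrank_fin_fun]
    exact le_antisymm (finrank_le_of_compl hAX) (finrank_le_of_compl hAX.symm)
  refine ⟨(LinearEquiv.ofInjectiveOfFinrankEq g hg hdim).symm, b.equivFun.symm, fun v p => ?_⟩
  rw [hsum]
  congr 1
  exact (LinearEquiv.ofInjectiveOfFinrankEq g hg hdim).apply_symm_apply v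

/-- A Lagrangian subspace that is the graph of a linear map `A → X` is parametrized by `A`. -/
def graphEquiv {A X C : Lagrangian ω} (hAX : Compl A X) (K : A →ₗ[ℝ] X)
    (hK : ∀ z : T, z ∈ C.toSubmodule ↔ ∃ v : A, z = K v + v) : A ≃ₗ[ℝ] C :=
  LinearEquiv.ofBijective
    ((X.toSubmodule.subtype ∘ₗ K + A.toSubmodule.subtype).codRestrict C.toSubmodule
      fun v => (hK _).2 ⟨v, rfl⟩) (by
    constructor
    · rw [← LinearMap.ker_eq_bot, LinearMap.ker_eq_bot']
      intro v hv
      have h1 : (K v : T) + v = 0 := congrArg Subtype.val hv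
      have h2 := congrArg (proj hAX) h1
      rw [map_add, proj_of_mem_right hAX (K v).2, proj_of_mem hAX v.2, zero_add, map_zero] at h2
      exact Subtype.ext h2
    · rintro ⟨z, hz⟩
      obtain ⟨v, rfl⟩ := (hK z).1 hz
      exact ⟨v, rfl⟩)

theorem coe_graphEquiv {A X C : Lagrangian ω} (hAX : Compl A X) (K : A →ₗ[ℝ] X)
    (hK : ∀ z : T, z ∈ C.toSubmodule ↔ ∃ v : A, z = K v + v) (v : A) :
    (graphEquiv hAX K hK v : T) = K v + v := rfl

/-- The map whose graph is Lagrangian is symmetric. -/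
theorem form_graph_symm {A X C : Lagrangian ω} {K : A →ₗ[ℝ] X}
    (hK : ∀ z : T, z ∈ C.toSubmodule ↔ ∃ v : A, z = K v + v) (v w : A) :
    ω v (K w) = ω w (K v) := by
  have h1 := C.isotropic ((hK _).2 ⟨v, rfl⟩) ((hK _).2 ⟨w, rfl⟩)
  simp only [map_add, LinearMap.add_apply, A.isotropic v.2 w.2, X.isotropic (K v).2 (K w).2,
    zero_add, add_zero] at h1
  have h2 := ω.neg_eq (w : T) (K v : T)
  linarith

section Matrix

variable {ι : Type*} [Fintype ι] [DecidableEq ι]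

theorem transpose_eq_of_dotProduct {k : Matrix ι ι ℝ}
    (h : ∀ v w : ι → ℝ, v ⬝ᵥ k *ᵥ w = w ⬝ᵥ k *ᵥ v) : kᵀ = k := by
  ext i j
  simpa using h (Pi.single j 1) (Pi.single i 1)

/-- If `1 - L` is positive definite with respect to some inner product, and `M` is the matrix of
`L`, then the matrices `1 - r M`, `0 ≤ r ≤ 1`, have positive determinant: `1 - r L` is a convex
combination of `1` and `1 - L`, hence injective, and the determinant is `1` at `r = 0`. -/
theorem det_pos_of_isPosDefOperator {M : Matrix ι ι ℝ} {E : Type*} [AddCommGroup E] [Module ℝ E]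
    (e : (ι → ℝ) ≃ₗ[ℝ] E) {L : E →ₗ[ℝ] E} (hL : ∀ v, L (e v) = e (M *ᵥ v))
    (h : IsPosDefOperator (LinearMap.id - L)) :
    ∀ r ∈ Set.Icc (0 : ℝ) 1, 0 < (1 - r • M).det := by
  obtain ⟨B, -, hB, hB'⟩ := h
  have hne : ∀ r ∈ Set.Icc (0 : ℝ) 1, (1 - r • M).det ≠ 0 := by
    intro r hr h0
    obtain ⟨v, hv, hv'⟩ := Matrix.exists_mulVec_eq_zero_iff.2 h0
    have hv1 : e v ≠ 0 := by simpa using hv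
    have h1 := hB _ hv1
    have h2 := hB' _ hv1
    rw [sub_mulVec, one_mulVec, smul_mulVec, sub_eq_zero] at hv'
    have h3 : e v = r • L (e v) := by rw [hL, ← map_smul, ← hv']
    have h4 : B (e v) (e v) = r * B (e v) (L (e v)) := by
      conv_lhs => rw [h3, ← h3]
      conv_lhs => arg 2; rw [h3]
      simp
    rw [LinearMap.sub_apply, LinearMap.id_apply, map_sub] at h2
    have hb : 0 < B (e v) (L (e v)) := by
      by_contra hb
      have := mul_nonpos_of_nonneg_of_nonpos hr.1 (not_lt.1 hb)
      linarith
    have := mul_le_of_le_one_left hb.le hr.2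
    linarith
  have hc : Continuous fun r : ℝ => (1 - r • M).det :=
    (continuous_const.sub (continuous_id.smul continuous_const)).matrix_det
  intro r hr
  by_contra hneg
  obtain ⟨t, ht, ht'⟩ := intermediate_value_Icc' hr.1 hc.continuousOn
    (show (0 : ℝ) ∈ Set.Icc _ _ from ⟨not_lt.1 hneg, by simp⟩)
  exact hne t ⟨ht.1, ht.2.trans hr.2⟩ ht'

/-- The linear automorphism `(p, w) ↦ (N w, p + k w)` scales Lebesgue measure by `1 / |det N|`,
being a shear composed with the exchange of the factors and `N`. -/
theorem map_mulVec_add_mulVec {N : Matrix ι ι ℝ} (hN : N.det ≠ 0) (k : Matrix ι ι ℝ) :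
    Measure.map (fun q : (ι → ℝ) × (ι → ℝ) => (N *ᵥ q.2, q.1 + k *ᵥ q.2))
      (volume.prod volume) = ‖N.det‖₊⁻¹ • (volume : Measure (ι → ℝ)).prod volume := by
  have hm : Measurable fun v : ι → ℝ => N *ᵥ v :=
    (Continuous.matrix_mulVec continuous_const continuous_id).measurable
  have h1 : Measure.map (fun v : ι → ℝ => N *ᵥ v) volume = ‖N.det‖₊⁻¹ • volume := by
    have h2 := Real.map_matrix_volume_pi_eq_smul_volume_pi hN
    have h3 : ENNReal.ofReal |N.det⁻¹| = ((‖N.det‖₊⁻¹ : ℝ≥0) : ENNReal) := by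
      rw [← Real.norm_eq_abs, ofReal_norm, ← nnnorm_inv, enorm_eq_nnnorm]
    rw [h3] at h2
    exact h2
  have hk : Measurable fun v : ι → ℝ => k *ᵥ v :=
    (Continuous.matrix_mulVec continuous_const continuous_id).measurable
  have h2 : MeasurePreserving (fun q : (ι → ℝ) × (ι → ℝ) => (N *ᵥ q.1, q.2 + k *ᵥ q.1))
      (volume.prod volume) ((‖N.det‖₊⁻¹ • volume : Measure (ι → ℝ)).prod volume) :=
    MeasurePreserving.skew_product (g := fun a c => c + k *ᵥ a) ⟨hm, h1⟩
      (measurable_snd.add (hk.comp measurable_fst))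
      (Filter.Eventually.of_forall fun a => map_add_right_eq_self volume (k *ᵥ a))
  have h3 : (fun q : (ι → ℝ) × (ι → ℝ) => (N *ᵥ q.2, q.1 + k *ᵥ q.2)) =
      (fun q : (ι → ℝ) × (ι → ℝ) => (N *ᵥ q.1, q.2 + k *ᵥ q.1)) ∘ Prod.swap := rfl
  rw [h3, ← Measure.map_map h2.measurable measurable_swap, Measure.prod_swap, h2.map_eq,
    Measure.prod_smul_left]

end Matrix

variable [MeasurableSpace T] [BorelSpace T] {ι : Type*} [Fintype ι] [DecidableEq ι]

theorem exists_eq_smul_map {A : Lagrangian ω} (e : (ι → ℝ) ≃ₗ[ℝ] A) (μ : Measure A)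
    [μ.IsAddHaarMeasure] : ∃ c : ℝ≥0, 0 < c ∧ μ = c • Measure.map e volume := by
  have : (Measure.map e (volume : Measure (ι → ℝ))).IsAddHaarMeasure :=
    e.toContinuousLinearEquiv.isAddHaarMeasure_map volume
  exact ⟨_, Measure.addHaarScalarFactor_pos_of_isAddHaarMeasure μ (Measure.map e volume),
    Measure.isAddLeftInvariant_eq_smul _ _⟩

theorem measurable_linearEquiv {A : Lagrangian ω} (e : (ι → ℝ) ≃ₗ[ℝ] A) : Measurable e :=
  e.toContinuousLinearEquiv.continuous.measurable

/-- The isomorphism `(v, p) ↦ e v + e' p` given by coordinates of complementary subspaces. -/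
def sumEquiv {A B : Lagrangian ω} (hAB : Compl A B) (e : (ι → ℝ) ≃ₗ[ℝ] A)
    (e' : (ι → ℝ) ≃ₗ[ℝ] B) : ((ι → ℝ) × (ι → ℝ)) ≃ₗ[ℝ] T :=
  (e.prodCongr e').trans (Submodule.prodEquivOfIsCompl _ _ hAB)

theorem sumEquiv_apply {A B : Lagrangian ω} (hAB : Compl A B) (e : (ι → ℝ) ≃ₗ[ℝ] A)
    (e' : (ι → ℝ) ≃ₗ[ℝ] B) (q : (ι → ℝ) × (ι → ℝ)) :
    sumEquiv hAB e e' q = e q.1 + e' q.2 := rfl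

instance {A B : Lagrangian ω} (hAB : Compl A B) (e : (ι → ℝ) ≃ₗ[ℝ] A) (e' : (ι → ℝ) ≃ₗ[ℝ] B) :
    (Measure.map (sumEquiv hAB e e') (volume.prod volume)).IsAddHaarMeasure :=
  have : ((volume : Measure (ι → ℝ)).prod (volume : Measure (ι → ℝ))).IsAddHaarMeasure :=
    Measure.prod.instIsAddHaarMeasure _ _
  (sumEquiv hAB e e').toContinuousLinearEquiv.isAddHaarMeasure_map
    ((volume : Measure (ι → ℝ)).prod (volume : Measure (ι → ℝ)))

/-- The density, relative to the Liouville measure, of the Lebesgue measure given by coordinates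
of complementary subspaces. -/
def coordDensity {A B : Lagrangian ω} (hAB : Compl A B) (e : (ι → ℝ) ≃ₗ[ℝ] A)
    (e' : (ι → ℝ) ≃ₗ[ℝ] B) : ℝ≥0 :=
  Measure.addHaarScalarFactor (Measure.map (sumEquiv hAB e e') (volume.prod volume)) ω.liouville

theorem coordDensity_pos {A B : Lagrangian ω} (hAB : Compl A B) (e : (ι → ℝ) ≃ₗ[ℝ] A)
    (e' : (ι → ℝ) ≃ₗ[ℝ] B) : 0 < coordDensity hAB e e' :=
  Measure.addHaarScalarFactor_pos_of_isAddHaarMeasure _ _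

theorem addHaarScalarFactor_eq_smul {μ μ' ν : Measure T} [ν.IsAddHaarMeasure]
    [μ.IsAddHaarMeasure] [μ'.IsAddHaarMeasure] {c : ℝ≥0} (h : μ = c • μ') :
    Measure.addHaarScalarFactor μ ν = c * Measure.addHaarScalarFactor μ' ν := by
  subst h
  exact Measure.addHaarScalarFactor_smul _ _

theorem relDensity_eq {A B : Lagrangian ω} (hAB : Compl A B) (e : (ι → ℝ) ≃ₗ[ℝ] A)
    (e' : (ι → ℝ) ≃ₗ[ℝ] B) {μ : Measure A} [μ.IsAddHaarMeasure] {μ' : Measure B}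
    [μ'.IsAddHaarMeasure] {c c' : ℝ≥0} (hμ : μ = c • Measure.map e volume)
    (hμ' : μ' = c' • Measure.map e' volume) :
    relDensity hAB μ μ' = c * c' * coordDensity hAB e e' := by
  have := (Submodule.prodEquivOfIsCompl _ _ hAB).toContinuousLinearEquiv.isAddHaarMeasure_map
    (μ.prod μ')
  refine addHaarScalarFactor_eq_smul ?_
  have h1 : μ.prod μ' = (c * c') • Measure.map (Prod.map e e') (volume.prod volume) := by
    rw [hμ, hμ', Measure.prod_smul_left, Measure.prod_smul_right, smul_smul,
      Measure.map_prod_map _ _ (measurable_linearEquiv e) (measurable_linearEquiv e')]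
  rw [h1, Measure.map_smul, Measure.map_map
    (Submodule.prodEquivOfIsCompl _ _ hAB).toContinuousLinearEquiv.continuous.measurable
    ((measurable_linearEquiv e).prodMap (measurable_linearEquiv e'))]
  rfl

/-- Change of the coordinate density when `C`, written as a graph over `A ⊕ X`, replaces `A`. -/
theorem coordDensity_graph {A X C : Lagrangian ω} (hAX : Compl A X) (hXC : Compl X C)
    (eA : (ι → ℝ) ≃ₗ[ℝ] A) (eX : (ι → ℝ) ≃ₗ[ℝ] X) (eC : (ι → ℝ) ≃ₗ[ℝ] C) {N k : Matrix ι ι ℝ}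
    (hN : N.det ≠ 0) (hC : ∀ w, (eC w : T) = eA (N *ᵥ w) + eX (k *ᵥ w)) :
    coordDensity hXC eX eC = ‖N.det‖₊⁻¹ * coordDensity hAX eA eX := by
  refine addHaarScalarFactor_eq_smul ?_
  have hm : Measurable fun q : (ι → ℝ) × (ι → ℝ) => (N *ᵥ q.2, q.1 + k *ᵥ q.2) :=
    ((Continuous.matrix_mulVec continuous_const continuous_snd).prodMk
      (continuous_fst.add (Continuous.matrix_mulVec continuous_const continuous_snd))).measurable
  have h1 : (sumEquiv hXC eX eC : (ι → ℝ) × (ι → ℝ) → T) =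
      sumEquiv hAX eA eX ∘ fun q : (ι → ℝ) × (ι → ℝ) => (N *ᵥ q.2, q.1 + k *ᵥ q.2) := by
    funext q
    simp only [Function.comp, sumEquiv_apply, hC, map_add, Submodule.coe_add]
    abel
  have hS : Measurable (sumEquiv hAX eA eX) :=
    (sumEquiv hAX eA eX).toContinuousLinearEquiv.continuous.measurable
  rw [h1, ← Measure.map_map hS hm,
    map_mulVec_add_mulVec hN, Measure.map_smul]

theorem coordDensity_comm {A X : Lagrangian ω} (hAX : Compl A X) (eA : (ι → ℝ) ≃ₗ[ℝ] A)
    (eX : (ι → ℝ) ≃ₗ[ℝ] X) : coordDensity hAX.symm eX eA = coordDensity hAX eA eX := by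
  have := coordDensity_graph hAX hAX.symm eA eX eA (N := 1) (k := 0) (by simp) (by simp)
  simpa using this

theorem integral_selfDual {h : ℝ} {A B : Lagrangian ω} (hAB : Compl A B) (μA : Measure A)
    [μA.IsAddHaarMeasure] (μB : Measure B) [μB.IsAddHaarMeasure] (e : (ι → ℝ) ≃ₗ[ℝ] B)
    {c : ℝ≥0} (hc : μB = c • Measure.map e volume) (F : B → ℂ) :
    ∫ b, F b ∂selfDual h hAB μA μB =
      ((NNReal.sqrt (‖h‖₊ ^ Fintype.card ι / relDensity hAB μA μB) * c : ℝ≥0) : ℂ) *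
        ∫ p, F (e p) := by
  have h1 : Module.finrank ℝ B = Fintype.card ι := by
    rw [← e.finrank_eq, Module.finrank_fintype_fun_eq_card]
  have h2 : ∫ b, F b ∂(Measure.map e volume) = ∫ p, F (e p) := by
    have : (e : (ι → ℝ) → B) = e.toContinuousLinearEquiv.toHomeomorph := rfl
    rw [this, e.toContinuousLinearEquiv.toHomeomorph.measurableEmbedding.integral_map]
  have h3 : selfDual h hAB μA μB =
      (NNReal.sqrt (‖h‖₊ ^ Fintype.card ι / relDensity hAB μA μB) * c) • Measure.map e volume := by
    rw [selfDual, h1, mul_smul, ← hc]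
  rw [h3, integral_smul_nnreal_measure, h2, NNReal.smul_def, Complex.real_smul]

end Coordinates

/-! ### Independence of the auxiliary Lagrangian subspace -/

section Intertwining

variable {T : Type*} [NormedAddCommGroup T] [NormedSpace ℝ T] [FiniteDimensional ℝ T]
  {ω : SymplecticForm T}

theorem ind_apply {h : ℝ} {A X : Lagrangian ω} (hAX : Compl A X) (f : 𝓢(X, ℂ))
    (g : Heisenberg ω) :
    (ind h hAX f).1 g = eh h (g.t - ω (proj hAX.symm g.z) g.z / 2) *
      f ⟨proj hAX.symm g.z, proj_mem _ _⟩ := rfl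

theorem ind_res {h : ℝ} {A X : Lagrangian ω} (hAX : Compl A X) (ψ : InvSchwartz h A) :
    ind h hAX (res hAX ψ) = ψ := by
  refine Subtype.ext (funext fun g => ?_)
  rw [ind_apply, res_apply, apply_eq_of_invariant hAX ψ.2.1 ψ.2.2.1 g]
  have h1 : ω (proj hAX.symm g.z) g.z = ω (proj hAX.symm g.z) (proj hAX g.z) := by
    conv_lhs => arg 2; rw [← proj_add_proj hAX g.z]
    rw [map_add, X.isotropic (proj_mem _ _) (proj_mem _ _), add_zero]
  rw [h1]

theorem res_ind {h : ℝ} {A X : Lagrangian ω} (hAX : Compl A X) (f : 𝓢(X, ℂ)) :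
    res hAX (ind h hAX f) = f := by
  ext x
  rw [res_apply, ind_apply]
  simp [proj_of_mem hAX.symm x.2, ω.alt, eh_zero]

/-- The isomorphism `𝓢(X) ≃ 𝓢(X')` that identifies the restrictions of an invariant function to
two complements of `A`. -/
def changeComplement (h : ℝ) {A X X' : Lagrangian ω} (hX : Compl A X) (hX' : Compl A X') :
    𝓢(X, ℂ) ≃ₗ[ℂ] 𝓢(X', ℂ) :=
  LinearEquiv.ofLinearMap (res hX' ∘ₗ ind h hX) (res hX ∘ₗ ind h hX')
    (LinearMap.ext fun f => by simp [ind_res, res_ind])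
    (LinearMap.ext fun f => by simp [ind_res, res_ind])

theorem changeComplement_apply (h : ℝ) {A X X' : Lagrangian ω} (hX : Compl A X)
    (hX' : Compl A X') (f : 𝓢(X, ℂ)) (z : X') :
    changeComplement h hX hX' f z = eh h (1 / 2 * ω (proj hX z) z) *
      f ⟨-reflection hX hX' z, neg_reflection_mem hX hX' z⟩ := by
  have h1 : changeComplement h hX hX' f z = res hX' (ind h hX f) z := rfl
  have h2 : ω (proj hX z) z + ω (proj hX.symm z) z = 0 := by
    rw [← LinearMap.add_apply, ← map_add, proj_add_proj, ω.alt]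
  rw [h1, res_apply, ind_apply]
  congr 2
  · change 0 - ω (proj hX.symm z) z / 2 = _
    linarith
  · exact Subtype.ext (neg_reflection_apply hX hX' z.2).symm

theorem eh_eq_phase (h t : ℝ) : eh h t = phase (h * t : ℝ) := by
  rw [eh, phase]
  congr 1
  push_cast
  ring

variable {ι : Type*} [Fintype ι] [DecidableEq ι]

theorem integrable_comp_coordinates {h : ℝ} {A B : Lagrangian ω} (hAB : Compl A B)
    (e : (ι → ℝ) ≃ₗ[ℝ] B) (ψ : InvSchwartz h A) :
    Integrable fun p : ι → ℝ => ψ.1 ⟨0, e p⟩ := by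
  obtain ⟨f, hf⟩ := ψ.2.2.2 B hAB
  have h1 := (SchwartzMap.compCLMOfContinuousLinearEquiv ℂ e.toContinuousLinearEquiv f).integrable
    (μ := (volume : Measure (ι → ℝ)))
  refine h1.congr (Filter.Eventually.of_forall fun p => ?_)
  simp [hf]

/-- Right `A`-invariance lets the component in `A` be dropped at the cost of a phase. -/
theorem apply_zero_add {h : ℝ} {A B : Lagrangian ω} (hAB : Compl A B) (ψ : InvSchwartz h A)
    {a b : T} (ha : a ∈ A.toSubmodule) (hb : b ∈ B.toSubmodule) (t : ℝ) :
    ψ.1 ⟨t, a + b⟩ = eh h (t - ω b a / 2) * ψ.1 ⟨0, b⟩ := by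
  rw [apply_eq_of_invariant hAB ψ.2.1 ψ.2.2.1]
  simp only [map_add, proj_of_mem hAB ha, proj_of_mem_right hAB hb, proj_of_mem hAB.symm hb,
    proj_of_mem_right hAB.symm ha, add_zero, zero_add]

variable [MeasurableSpace T] [BorelSpace T]

theorem fourier_apply {h : ℝ} (hh : h ≠ 0) {A B : Lagrangian ω} (hAB : Compl A B)
    (μA : Measure A) [μA.IsAddHaarMeasure] (μB : Measure B) [μB.IsAddHaarMeasure]
    (ψ : InvSchwartz h A) (g : Heisenberg ω) :
    (fourier hh hAB μA μB ψ).1 g = ∫ b : B, ψ.1 (g * ⟨0, b⟩) ∂selfDual h hAB μA μB := rfl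

/-- In dual coordinates, `δ_X *` is the Fourier transform. -/
theorem fourier_apply_coordinates {h : ℝ} (hh : h ≠ 0) {A X : Lagrangian ω} (hAX : Compl A X)
    (μA : Measure A) [μA.IsAddHaarMeasure] (μX : Measure X) [μX.IsAddHaarMeasure]
    (eA : (ι → ℝ) ≃ₗ[ℝ] A) (eX : (ι → ℝ) ≃ₗ[ℝ] X)
    (hdual : ∀ v p, h * ω (eA v) (eX p) = v ⬝ᵥ p) {β : ℝ≥0} (hβ : μX = β • Measure.map eX volume)
    (ψ : InvSchwartz h A) (v : ι → ℝ) :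
    (fourier hh hAX μA μX ψ).1 ⟨0, eA v⟩ =
      ((NNReal.sqrt (‖h‖₊ ^ Fintype.card ι / relDensity hAX μA μX) * β : ℝ≥0) : ℂ) *
        ∫ p : ι → ℝ, phase (v ⬝ᵥ p : ℝ) * ψ.1 ⟨0, eX p⟩ := by
  rw [fourier_apply, integral_selfDual hAX μA μX eX hβ]
  congr 1
  refine integral_congr_ae (Filter.Eventually.of_forall fun p => ?_)
  change ψ.1 ⟨0 + 0 + ω (eA v) (eX p) / 2, eA v + eX p⟩ =
    phase (v ⬝ᵥ p : ℝ) * ψ.1 ⟨0, eX p⟩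
  rw [apply_zero_add hAX ψ (eA v).2 (eX p).2, eh_eq_phase, ← hdual v p, ← ω.neg_eq (eA v : T)]
  congr 3
  ring

/-- The convolution `δ_C *` on right `X`-invariant functions, for a Lagrangian subspace `C`
written as a graph over `A ⊕ X`. -/
theorem fourier_apply_graph {h : ℝ} (hh : h ≠ 0) {A X C : Lagrangian ω} (hAX : Compl A X)
    (hXC : Compl X C) (μX : Measure X) [μX.IsAddHaarMeasure] (μC : Measure C)
    [μC.IsAddHaarMeasure] (eA : (ι → ℝ) ≃ₗ[ℝ] A) (eX : (ι → ℝ) ≃ₗ[ℝ] X) (eC : (ι → ℝ) ≃ₗ[ℝ] C)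
    (hdual : ∀ v p, h * ω (eA v) (eX p) = v ⬝ᵥ p) {γ : ℝ≥0} (hγ : μC = γ • Measure.map eC volume)
    {N k : Matrix ι ι ℝ} (hC : ∀ w, (eC w : T) = eA (N *ᵥ w) + eX (k *ᵥ w))
    (φ : InvSchwartz h X) (a b : ι → ℝ) :
    (fourier hh hXC μX μC φ).1 ⟨0, eA a + eX b⟩ =
      ((NNReal.sqrt (‖h‖₊ ^ Fintype.card ι / relDensity hXC μX μC) * γ : ℝ≥0) : ℂ) *
        ∫ w : ι → ℝ,
          phase (-(b ⬝ᵥ N *ᵥ w) - 1 / 2 * (a ⬝ᵥ b) - 1 / 2 * (N *ᵥ w ⬝ᵥ k *ᵥ w) : ℝ) *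
            φ.1 ⟨0, eA (a + N *ᵥ w)⟩ := by
  rw [fourier_apply, integral_selfDual hXC μX μC eC hγ]
  congr 1
  refine integral_congr_ae (Filter.Eventually.of_forall fun w => ?_)
  have h1 : (eA a + eX b : T) + eC w = eX (b + k *ᵥ w) + eA (a + N *ᵥ w) := by
    rw [hC, map_add, map_add, Submodule.coe_add, Submodule.coe_add]
    abel
  have h2 : h * ω (eA a + eX b) (eC w) = a ⬝ᵥ k *ᵥ w - N *ᵥ w ⬝ᵥ b := by
    rw [hC, ← hdual, ← hdual]
    simp only [map_add, LinearMap.add_apply, A.isotropic (eA a).2 (eA (N *ᵥ w)).2,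
      X.isotropic (eX b).2 (eX (k *ᵥ w)).2, ← ω.neg_eq (eA (N *ᵥ w) : T) (eX b : T)]
    ring
  change φ.1 ⟨0 + 0 + ω (eA a + eX b) (eC w) / 2, (eA a + eX b : T) + eC w⟩ = _
  rw [h1, apply_zero_add hAX.symm φ (eX _).2 (eA _).2, eh_eq_phase]
  congr 2
  have h3 := hdual (a + N *ᵥ w) (b + k *ᵥ w)
  simp only [dotProduct_add, add_dotProduct] at h3
  have h4 := dotProduct_comm b (N *ᵥ w)
  have h5 : h * (0 + 0 + ω (eA a + eX b) (eC w) / 2 -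
      ω (eA (a + N *ᵥ w)) (eX (b + k *ᵥ w)) / 2) =
      (h * ω (eA a + eX b) (eC w) - h * ω (eA (a + N *ᵥ w)) (eX (b + k *ᵥ w))) / 2 := by ring
  rw [h5, h2, h3, h4]
  congr 1
  ring

/-- The normalizing constants of the two composite transforms differ by `d ^ (1 / 2)`. Here
`α, β, β', γ` are the densities of the Haar measures of `A`, `X`, `X'`, `C` in coordinates, `D` is
the common density of the coordinates themselves, `d` is the determinant that relates the
coordinates of `X' ⊕ C` to those of `A ⊕ X'`, and `m` is the power of `|h|`. -/
theorem sqrt_constants {m α β β' γ D d : ℝ≥0} (hα : 0 < α) (hβ : 0 < β) (hβ' : 0 < β')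
    (hγ : 0 < γ) (hD : 0 < D) (hd : 0 < d) :
    NNReal.sqrt (m / (β * γ * D)) * γ * (NNReal.sqrt (m / (α * β * D)) * β) * NNReal.sqrt d =
      NNReal.sqrt (m / (β' * γ * (d⁻¹ * D))) * γ * (NNReal.sqrt (m / (α * β' * D)) * β') := by
  have h1 : ∀ x : ℝ≥0, NNReal.sqrt x ^ 2 = x := NNReal.sq_sqrt
  refine (pow_left_inj₀ zero_le zero_le two_ne_zero).1 ?_
  simp only [mul_pow, h1]
  field_simp

/-- The composite `δ_C * δ_X *`, from right `A`-invariant to right `C`-invariant functions, does not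
change when `X` is replaced by the graph `X'` of `Y`, if `C` is the graph of `K` and `1 - Y K` is
positive definite. It suffices to compare values on `X'`, as `X'` is a complement of `C`. -/
theorem fourier_fourier_eq {h : ℝ} (hh : h ≠ 0) {A X X' C : Lagrangian ω} (hAX : Compl A X)
    (hAX' : Compl A X') (hXC : Compl X C) (hXC' : Compl X' C)
    (Y : X →ₗ[ℝ] A) (hY : ∀ z : T, z ∈ X'.toSubmodule ↔ ∃ x : X, z = Y x + x)
    (K : A →ₗ[ℝ] X) (hK : ∀ z : T, z ∈ C.toSubmodule ↔ ∃ v : A, z = K v + v)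
    (hpos : IsPosDefOperator (LinearMap.id - Y ∘ₗ K))
    (μA : Measure A) [μA.IsAddHaarMeasure] (μX : Measure X) [μX.IsAddHaarMeasure]
    (μX' : Measure X') [μX'.IsAddHaarMeasure] (μC : Measure C) [μC.IsAddHaarMeasure]
    (ψ : InvSchwartz h A) (z : X') :
    (fourier hh hXC μX μC (fourier hh hAX μA μX ψ)).1 ⟨0, z⟩ =
      (fourier hh hXC' μX' μC (fourier hh hAX' μA μX' ψ)).1 ⟨0, z⟩ := by
  obtain ⟨eA, eX, hdual⟩ := exists_dual_coordinates hh hAX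
  let k := LinearMap.toMatrix' (eX.symm.toLinearMap ∘ₗ K ∘ₗ eA.toLinearMap)
  let y := LinearMap.toMatrix' (eA.symm.toLinearMap ∘ₗ Y ∘ₗ eX.toLinearMap)
  have hKk : ∀ v, K (eA v) = eX (k *ᵥ v) := fun v => by
    simp [k, LinearMap.toMatrix'_mulVec]
  have hYy : ∀ p, Y (eX p) = eA (y *ᵥ p) := fun p => by
    simp [y, LinearMap.toMatrix'_mulVec]
  have hk : kᵀ = k := transpose_eq_of_dotProduct fun v w => by
    rw [← hdual, ← hdual, ← hKk, ← hKk, form_graph_symm hK]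
  have hy : yᵀ = y := transpose_eq_of_dotProduct fun v w => by
    rw [dotProduct_comm, dotProduct_comm w, ← hdual, ← hdual, ← hYy, ← hYy,
      ← ω.neg_eq (eX w : T), ← ω.neg_eq (eX v : T), form_graph_symm hY]
  have hdet : ∀ r ∈ Set.Icc (0 : ℝ) 1, 0 < (1 - (r • y) * k).det := by
    have h1 := det_pos_of_isPosDefOperator (M := y * k) eA (L := Y ∘ₗ K)
      (fun v => by rw [LinearMap.comp_apply, hKk, hYy, mulVec_mulVec]) hpos
    simpa only [Matrix.smul_mul] using h1
  have hN : 0 < (1 - y * k).det := by simpa using hdet 1 (by simp)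
  let eC := eA.trans (graphEquiv hAX K hK)
  let eX' := eX.trans (graphEquiv hAX.symm Y hY)
  have heX' : ∀ p, (eX' p : T) = eA (y *ᵥ p) + eX p := fun p => by
    simp only [eX', LinearEquiv.trans_apply, coe_graphEquiv, hYy]
  have heC : ∀ w, (eC w : T) = eA ((1 : Matrix _ _ ℝ) *ᵥ w) + eX (k *ᵥ w) := fun w => by
    simp only [eC, LinearEquiv.trans_apply, coe_graphEquiv, hKk, one_mulVec, add_comm]
  -- With respect to `T = A ⊕ X'` the component of `eC w` in `A` is `(1 - y k) w`.
  have heC' : ∀ w, (eC w : T) = eA ((1 - y * k) *ᵥ w) + eX' (k *ᵥ w) := fun w => by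
    rw [heC, heX', sub_mulVec, one_mulVec, map_sub, ← mulVec_mulVec, Submodule.coe_sub]
    abel
  have hdual' : ∀ v p, h * ω (eA v) (eX' p) = v ⬝ᵥ p := fun v p => by
    rw [heX', map_add, A.isotropic (eA v).2 (eA _).2, zero_add, hdual]
  obtain ⟨α, hα, hα'⟩ := exists_eq_smul_map eA μA
  obtain ⟨β, hβ, hβ'⟩ := exists_eq_smul_map eX μX
  obtain ⟨b, hb, hb'⟩ := exists_eq_smul_map eX' μX'
  obtain ⟨γ, hγ, hγ'⟩ := exists_eq_smul_map eC μC
  set D := coordDensity hAX eA eX with hD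
  have hD0 : 0 < D := coordDensity_pos _ _ _
  have hD' : coordDensity hAX' eA eX' = D := by
    rw [coordDensity_graph hAX.symm hAX' eX eA eX' (N := 1) (k := y) (by simp)
      (fun w => by rw [heX', one_mulVec, add_comm]), coordDensity_comm hAX]
    simp [hD]
  have hDC : coordDensity hXC eX eC = D := by
    rw [coordDensity_graph hAX hXC eA eX eC (by simp) heC]
    simp [hD]
  have hDC' : coordDensity hXC' eX' eC = ‖(1 - y * k).det‖₊⁻¹ * D := by
    rw [coordDensity_graph hAX' hXC' eA eX' eC hN.ne' heC', hD']
  obtain ⟨x, rfl⟩ := eX'.surjective z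
  let f : (Fin (Module.finrank ℝ X) → ℝ) → ℂ := fun p => ψ.1 ⟨0, eX p⟩
  have hf : Integrable f := integrable_comp_coordinates hAX eX ψ
  have hf' : ∀ p, ψ.1 ⟨0, eX' p⟩ = phase (1 / 2 * (p ⬝ᵥ y *ᵥ p) : ℝ) * f p := fun p => by
    rw [heX', apply_zero_add hAX ψ (eA _).2 (eX _).2, eh_eq_phase, dotProduct_comm, ← hdual,
      ← ω.neg_eq (eA _ : T)]
    congr 3
    ring
  have hF := fourier_apply_coordinates hh hAX μA μX eA eX hdual hβ' ψ
  have hF' := fourier_apply_coordinates hh hAX' μA μX' eA eX' hdual' hb' ψ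
  have hh0 : (0 : ℝ≥0) < ‖h‖₊ ^ Fintype.card (Fin (Module.finrank ℝ X)) :=
    pow_pos (nnnorm_pos.2 hh) _
  rw [relDensity_eq hAX eA eX hα' hβ', ← hD] at hF
  rw [relDensity_eq hAX' eA eX' hα' hb', hD'] at hF'
  simp only [hf'] at hF'
  -- The inner integrals are integrable, being restrictions to `A` of invariant Schwartz functions.
  have hint : ∀ {c : ℝ≥0} {F G : (Fin (Module.finrank ℝ X) → ℝ) → ℂ}, 0 < c →
      (∀ v, F v = (c : ℂ) * G v) → Integrable F → Integrable G := by
    intro c F G hc hFG hF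
    have hc' : (c : ℂ) ≠ 0 := by exact_mod_cast hc.ne'
    refine (hF.const_mul (c : ℂ)⁻¹).congr (Filter.Eventually.of_forall fun v => ?_)
    simp only [hFG, inv_mul_cancel_left₀ hc']
  have hi₁ := hint (by positivity) hF (integrable_comp_coordinates hAX.symm eA _)
  have hi₂ := hint (by positivity) hF' (integrable_comp_coordinates hAX'.symm eA _)
  have hcore := oscInt_mobius hk hy hdet x hf hi₁ hi₂
  have hL := fourier_apply_graph hh hAX hXC μX μC eA eX eC hdual hγ' heC
    (fourier hh hAX μA μX ψ) (y *ᵥ x) x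
  have hR := fourier_apply_graph hh hAX' hXC' μX' μC eA eX' eC hdual' hγ' heC'
    (fourier hh hAX' μA μX' ψ) 0 x
  rw [← heX'] at hL
  rw [map_zero, Submodule.coe_zero, zero_add] at hR
  -- Through `X`: the substitution `v = y x + w` turns the graph coordinate `w` into the
  -- momentum `v`.
  have hLi : ∫ w : Fin (Module.finrank ℝ X) → ℝ,
      phase (-(x ⬝ᵥ (1 : Matrix _ _ ℝ) *ᵥ w) - 1 / 2 * (y *ᵥ x ⬝ᵥ x) -
        1 / 2 * ((1 : Matrix _ _ ℝ) *ᵥ w ⬝ᵥ k *ᵥ w) : ℝ) *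
        (fourier hh hAX μA μX ψ).1 ⟨0, eA (y *ᵥ x + (1 : Matrix _ _ ℝ) *ᵥ w)⟩ =
      ((NNReal.sqrt (‖h‖₊ ^ Fintype.card (Fin (Module.finrank ℝ X)) / (α * β * D)) * β : ℝ≥0) : ℂ) *
        (phase (1 / 2 * (x ⬝ᵥ y *ᵥ x) : ℝ) * oscInt (k.map Complex.ofReal) (y *ᵥ x) x f) := by
    rw [oscInt, ← integral_const_mul, ← integral_const_mul]
    refine Eq.trans ?_ (integral_add_left_eq_self _ (y *ᵥ x))
    refine integral_congr_ae (Filter.Eventually.of_forall fun w => ?_)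
    simp only [one_mulVec, hF, add_sub_cancel_left, quad_map_ofReal]
    have h1 : phase (-(x ⬝ᵥ w) - 1 / 2 * (y *ᵥ x ⬝ᵥ x) - 1 / 2 * (w ⬝ᵥ k *ᵥ w) : ℝ) =
        phase (1 / 2 * (x ⬝ᵥ y *ᵥ x) : ℝ) *
          phase ((-(x ⬝ᵥ (y *ᵥ x + w)) : ℝ) - 1 / 2 * (w ⬝ᵥ k *ᵥ w : ℝ)) := by
      rw [← phase_add, dotProduct_comm (y *ᵥ x), dotProduct_add]
      congr 1
      push_cast
      ring
    rw [h1]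
    ring
  -- Through `X'`: the substitution `v = (1 - y k) w`, because `C` is the graph of
  -- `k (1 - y k)⁻¹` over `A` when `X` is replaced by `X'`.
  have hRi : ∫ w : Fin (Module.finrank ℝ X) → ℝ,
      phase (-(x ⬝ᵥ (1 - y * k) *ᵥ w) - 1 / 2 * ((0 : Fin (Module.finrank ℝ X) → ℝ) ⬝ᵥ x) -
        1 / 2 * ((1 - y * k) *ᵥ w ⬝ᵥ k *ᵥ w) : ℝ) *
        (fourier hh hAX' μA μX' ψ).1 ⟨0, eA (0 + (1 - y * k) *ᵥ w)⟩ =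
      ((1 - y * k).det : ℂ)⁻¹ *
      (((NNReal.sqrt (‖h‖₊ ^ Fintype.card (Fin (Module.finrank ℝ X)) / (α * b * D)) * b : ℝ≥0) :
        ℂ) *
        oscInt (mobius y (k.map Complex.ofReal)) 0 x
          fun p => phase (1 / 2 * (p ⬝ᵥ y *ᵥ p) : ℝ) * f p) := by
    have hN0 : ((1 - y * k).det : ℂ) ≠ 0 := by exact_mod_cast hN.ne'
    rw [oscInt, ← integral_const_mul]
    refine Eq.trans ?_ (congrArg (_ * ·) (integral_mulVec hN.ne' _).symm)
    rw [abs_of_pos hN, inv_mul_cancel_left₀ hN0]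
    refine integral_congr_ae (Filter.Eventually.of_forall fun w => ?_)
    simp only [zero_add, sub_zero, hF', quad_mobius_mulVec hN.ne', zero_dotProduct, mul_zero]
    push_cast
    ring
  rw [hL, hR, hLi, hRi, hcore, relDensity_eq hXC eX eC hβ' hγ', relDensity_eq hXC' eX' eC hb' hγ',
    hDC, hDC']
  -- The factor `(det (1 - y k)) ^ (1 / 2)` from `oscInt_mobius` and the one from the self-dual
  -- measures cancel the Jacobian `det (1 - y k)` of the last substitution.
  have hnn : 0 < ‖(1 - y * k).det‖₊ := nnnorm_pos.2 hN.ne'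
  have hconst := sqrt_constants (m := ‖h‖₊ ^ Fintype.card (Fin (Module.finrank ℝ X)))
    hα hβ hb hγ hD0 hnn
  have hs : ((NNReal.sqrt ‖(1 - y * k).det‖₊ : ℝ≥0) : ℝ) = Real.sqrt (1 - y * k).det := by
    rw [Real.coe_sqrt, coe_nnnorm, Real.norm_of_nonneg hN.le]
  have hs2 : ((Real.sqrt (1 - y * k).det : ℝ) : ℂ) * (Real.sqrt (1 - y * k).det : ℝ) =
      ((1 - y * k).det : ℝ) := by exact_mod_cast Real.mul_self_sqrt hN.le
  have hN0 : ((1 - y * k).det : ℂ) ≠ 0 := by exact_mod_cast hN.ne'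
  have hconst' := congrArg (fun r : ℝ≥0 => ((r : ℝ) : ℂ)) hconst
  simp only [NNReal.coe_mul, hs, Complex.ofReal_mul] at hconst'
  have hs3 : ((1 - y * k).det : ℂ)⁻¹ * (Real.sqrt (1 - y * k).det : ℝ) *
      (Real.sqrt (1 - y * k).det : ℝ) = 1 := by
    rw [mul_assoc, hs2, inv_mul_cancel₀ hN0]
  generalize phase (1 / 2 * (x ⬝ᵥ y *ᵥ x) : ℝ) * oscInt (k.map Complex.ofReal) (y *ᵥ x) x f = J
  simp only [NNReal.coe_mul, Complex.ofReal_mul]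
  linear_combination (((1 - y * k).det : ℂ)⁻¹ * (Real.sqrt (1 - y * k).det : ℝ) * J) * hconst' -
    (((NNReal.sqrt (‖h‖₊ ^ Fintype.card (Fin (Module.finrank ℝ X)) / (β * γ * D)) : ℝ≥0) : ℂ) * γ *
      (((NNReal.sqrt (‖h‖₊ ^ Fintype.card (Fin (Module.finrank ℝ X)) / (α * β * D)) : ℝ≥0) : ℂ) *
        β) * J) * hs3

end Intertwining

end PlaneWave

end

theorem mainTheorem2 {T : Type*} [NormedAddCommGroup T] [NormedSpace ℝ T] [FiniteDimensional ℝ T]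
    [MeasurableSpace T] [BorelSpace T] (ω : PlaneWave.SymplecticForm T) (h : ℝ) (hh : h ≠ 0)
    (U : Set ℝ) (hU : U.OrdConnected)
    (H : ℝ → PlaneWave.Lagrangian ω) (hH : PlaneWave.IsPositiveCurve U H)
    (X X' : PlaneWave.Lagrangian ω)
    (hX : ∀ u : U, PlaneWave.Compl (H u) X) (hX' : ∀ u : U, PlaneWave.Compl (H u) X')
    (s : U)
    (Y : X →ₗ[ℝ] H s) (hY : ∀ z : T, z ∈ X'.toSubmodule ↔ ∃ x : X, z = Y x + x)
    (K : U → (H s →ₗ[ℝ] X))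
    (hK : ∀ (u : U) (z : T), z ∈ (H u).toSubmodule ↔ ∃ v : H s, z = K u v + v)
    (hclose : ∀ u : U, PlaneWave.IsPosDefOperator (LinearMap.id - Y ∘ₗ K u))
    (F : PlaneWave.FieldBundle U H)
    (ν : ∀ u : U, Measure (H u)) [∀ u, (ν u).IsAddHaarMeasure]
    (μ : Measure X) [μ.IsAddHaarMeasure] (μ' : Measure X') [μ'.IsAddHaarMeasure] :
    ∃ ρ : ∀ _ : U, 𝓢(X, ℂ) ≃ₗ[ℂ] 𝓢(X', ℂ),
      (∀ (u : U) (f : 𝓢(X, ℂ)) (z : X'),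
        ρ u f z = PlaneWave.eh h (1 / 2 * ω (PlaneWave.proj (hX u) z) z) *
          f ⟨-PlaneWave.reflection (hX u) (hX' u) z,
            PlaneWave.neg_reflection_mem (hX u) (hX' u) z⟩) ∧
      (∀ (u : U) (f : 𝓢(X', ℂ)) (z : X),
        (ρ u).symm f z = PlaneWave.eh h (1 / 2 * ω (PlaneWave.proj (hX' u) z) z) *
          f ⟨-PlaneWave.reflection (hX' u) (hX u) z,
            PlaneWave.neg_reflection_mem (hX' u) (hX u) z⟩) ∧
      ∀ u : U,
        (ρ u).toLinearMap.rTensor (F.at u) ∘ₗ PlaneWave.evolution hh F ν μ hX s u =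
          PlaneWave.evolution hh F ν μ' hX' s u ∘ₗ (ρ s).toLinearMap.rTensor (F.at s) := by

  refine ⟨fun u => PlaneWave.changeComplement h (hX u) (hX' u),
    fun u f z => PlaneWave.changeComplement_apply h (hX u) (hX' u) f z,
    fun u f z => PlaneWave.changeComplement_apply h (hX' u) (hX u) f z, fun u => ?_⟩
  refine TensorProduct.ext' fun f e => ?_
  simp only [PlaneWave.evolution, LinearMap.comp_apply, LinearMap.rTensor_tmul,
    LinearMap.lTensor_tmul]
  congr 1
  ext z
  change PlaneWave.res (hX' u) (PlaneWave.ind h (hX u) (PlaneWave.res (hX u) _)) z =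
    PlaneWave.res (hX' u) (PlaneWave.fourier hh (hX' u).symm μ' (ν u)
      (PlaneWave.fourier hh (hX' s) (ν s) μ' (PlaneWave.ind h (hX' s)
        (PlaneWave.res (hX' s) (PlaneWave.ind h (hX s) f))))) z
  rw [PlaneWave.ind_res, PlaneWave.ind_res, PlaneWave.res_apply, PlaneWave.res_apply]
  exact PlaneWave.fourier_fourier_eq hh (hX s) (hX' s) (hX u).symm (hX' u).symm Y hY (K u) (hK u)
    (hclose u) (ν s) μ μ' (ν u) _ z
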